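/- Let $\mathfrak H$ be a complex Hilbert space. A nest $\mathcal N$ on $\mathfrak H$ is a chain of closed subspaces of $\mathfrak H$ that contains $\{0\}$ and $\mathfrak H$ and is closed under arbitrary intersections and closed linear spans. Its nest algebra $\mathcal T(\mathcal N)$ is the algebra of all $T\in B(\mathfrak H)$ that leave every element of $\mathcal N$ invariant, and its quasi-triangular algebra is $\mathcal T(\mathcal N)+\mathcal K$, where $\mathcal K$ is the set of compact operators on $\mathfrak H$; both carry the operator norm of $B(\mathfrak H)$. Proposition 3.2. Let $\mathfrak B$ be the nest algebra or the quasi-triangular algebra of a nest $\mathcal N$ on $\mathfrak H$. Let $\alpha$ be a flow on $\mathfrak B$, that is, a group homomorphism $t\mapsto\alpha_t$ from $\mathbb R$ into the group of bounded (complex linear) algebra automorphisms of $\mathfrak B$ such that $t\mapsto\alpha_t(A)$ is norm continuous for every $A\in\mathfrak B$. Suppose that $\|\alpha_t-\mathrm{id}\|=O(t)$ as $t\to0$, where the norm is that of bounded linear operators on $\mathfrak B$. Then there is $P\in\mathfrak B$ such that $$\alpha_t(A)=e^{tP}Ae^{-tP}\qquad\text{for all } t\in\mathbb R,\ A\in\mathfrak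 B,$$ that is, $\alpha$ is an inner flow. -/

import Mathlib

open Filter Topology Asymptotics

section NestAlgebras

variable {H : Type*} [NormedAddCommGroup H] [InnerProductSpace ℂ H]

/-- A nest on `H`: a chain of closed subspaces of `H` that contains `{0}` and `H` and is closed
under arbitrary intersections and arbitrary closed linear spans. -/
structure Nest (H : Type*) [NormedAddCommGroup H] [InnerProductSpace ℂ H] where
  carrier : Set (Submodule ℂ H)
  isClosed_of_mem : ∀ M ∈ carrier, IsClosed (M : Set H)
  chain : ∀ M ∈ carrier, ∀ L ∈ carrier, M ≤ L ∨ L ≤ M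
  bot_mem : ⊥ ∈ carrier
  top_mem : ⊤ ∈ carrier
  sInf_mem : ∀ S ⊆ carrier, sInf S ∈ carrier
  closedSpan_mem : ∀ S ⊆ carrier, (sSup S).topologicalClosure ∈ carrier

/-- The nest algebra `𝒯(𝒩)`: all bounded operators leaving every element of the nest invariant. -/
def nestAlgebra (N : Nest H) : Subalgebra ℂ (H →L[ℂ] H) where
  carrier := {T | ∀ M ∈ N.carrier, ∀ x ∈ M, T x ∈ M}
  mul_mem' := fun {_ _} hS hT M hM x hx => hS M hM _ (hT M hM x hx)
  add_mem' := fun {_ _} hS hT M hM x hx => M.add_mem (hS M hM x hx) (hT M hM x hx)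
  algebraMap_mem' := fun r M _ x hx => by
    simpa [Algebra.algebraMap_eq_smul_one] using M.smul_mem r hx

/-- The quasi-triangular algebra `𝒯(𝒩) + 𝒦`, where `𝒦` is the set of compact operators on `H`. -/
def quasiTriangularAlgebra (N : Nest H) : Subalgebra ℂ (H →L[ℂ] H) where
  carrier := {T | ∃ A ∈ nestAlgebra N, ∃ K : H →L[ℂ] H, IsCompactOperator K ∧ T = A + K}
  mul_mem' := by
    rintro _ _ ⟨A, hA, K, hK, rfl⟩ ⟨B, hB, L, hL, rfl⟩
    refine ⟨A * B, mul_mem hA hB, A * L + K * (B + L), ?_, by noncomm_ring⟩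
    exact (hL.clm_comp A).add (hK.comp_clm (B + L))
  add_mem' := by
    rintro _ _ ⟨A, hA, K, hK, rfl⟩ ⟨B, hB, L, hL, rfl⟩
    exact ⟨A + B, add_mem hA hB, K + L, hK.add hL, by abel⟩
  algebraMap_mem' := fun r =>
    ⟨algebraMap ℂ _ r, (nestAlgebra N).algebraMap_mem r, 0, isCompactOperator_zero, by simp⟩

end NestAlgebras

/-- A flow on a normed algebra `B`: a homomorphism `t ↦ α t` of the real line into the group of
bounded (i.e. continuous, with continuous inverse) algebra automorphisms of `B` such that
`t ↦ α t b` is norm continuous for every `b`. -/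
structure AlgebraFlow (B : Type*) [NormedRing B] [NormedAlgebra ℂ B] where
  toFun : ℝ → (B ≃A[ℂ] B)
  map_add : ∀ s t b, toFun (s + t) b = toFun s (toFun t b)
  continuous_apply : ∀ b, Continuous fun t => toFun t b

/-! Generator. The bound `O(t)` makes the difference quotients of `t ↦ α t b` Cauchy as `t`
decreases to 0, so the flow has a bounded generator `δ`. It is a derivation of `B` with values in
the norm closure of `B`; nothing is assumed about closedness of `B`, so limits are taken in `B(H)`.
If `δ b = P b - b P` with `P ∈ B`, then `exp(-tP) (α t b) exp(tP)` has zero right derivative, hence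
is constant.

Implementation. With `y` a unit vector and `x ⊗ y` the rank one operator `z ↦ ⟨y, z⟩ x`, put `P x =
δ(x ⊗ y) y`. Since `b (x ⊗ y) = (b x) ⊗ y`, the Leibniz rule gives `P b x = δ(b) x + b P x`. In the
quasi-triangular algebra every `x ⊗ y` is available. In a nest algebra, one `y` serves for all `x`
only when the proper elements of the nest do not span a dense subspace; otherwise implementers on
the proper elements, all bounded by the same constant, have a weak operator limit.

Membership `P ∈ B`. For the nest algebra, which is norm closed, it suffices to apply `δ` to the
projections of the nest. For the quasi-triangular algebra only `P A - A P ∈ closure B` is known, for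
`A` in the nest algebra. The corners `(1 - e) P e` are then compact, and a gliding hump argument
(`false_of_disjoint_blocks`) cuts the nest into finitely many intervals inside which the corners of
`P` are small. Filling in one interval after another with Parrott's lemma
(`exists_compact_of_reflTransGen`) gives a compact `K`, of norm controlled by the corners of `P`,
such that the corners of `P - K` are at most half the previous bound. Iterating, the compact
corrections form a convergent series, and what remains has zero corners, so lies in the nest
algebra. -/

/-! ### Orthogonal projections onto closed subspaces -/

section ClosedProjections

variable {H : Type*} [NormedAddCommGroup H] [InnerProductSpace ℂ H] [CompleteSpace H]

/-- The orthogonal projection onto the closure of a subspace, as an operator on `H`. -/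
noncomputable def closedProj (M : Submodule ℂ H) : H →L[ℂ] H :=
  M.topologicalClosure.starProjection

theorem closedProj_apply_mem {M : Submodule ℂ H} (hM : IsClosed (M : Set H)) (x : H) :
    closedProj M x ∈ M := by
  have h := M.topologicalClosure.starProjection_apply_mem x
  exact hM.submodule_topologicalClosure_eq.le h

theorem closedProj_eq_self {M : Submodule ℂ H} {x : H} (hx : x ∈ M) : closedProj M x = x :=
  Submodule.starProjection_eq_self_iff.2 (M.le_topologicalClosure hx)

theorem norm_closedProj_le (M : Submodule ℂ H) : ‖closedProj M‖ ≤ 1 :=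
  Submodule.starProjection_norm_le _

theorem norm_closedProj_apply_le (M : Submodule ℂ H) (x : H) : ‖closedProj M x‖ ≤ ‖x‖ :=
  Submodule.norm_starProjection_apply_le _ x

theorem isSelfAdjoint_closedProj (M : Submodule ℂ H) : IsSelfAdjoint (closedProj M) :=
  isSelfAdjoint_starProjection _

theorem inner_closedProj_left (M : Submodule ℂ H) (x y : H) :
    inner ℂ (closedProj M x) y = inner ℂ x (closedProj M y) :=
  Submodule.inner_starProjection_left_eq_right _ x y

theorem closedProj_mul_of_le {M L : Submodule ℂ H} (h : M ≤ L) :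
    closedProj M * closedProj L = closedProj M :=
  Submodule.starProjection_comp_starProjection_of_le (Submodule.topologicalClosure_mono h)

theorem closedProj_mul_of_ge {M L : Submodule ℂ H} (h : M ≤ L) :
    closedProj L * closedProj M = closedProj M := by
  have := congrArg star (closedProj_mul_of_le h)
  rwa [star_mul, (isSelfAdjoint_closedProj M).star_eq, (isSelfAdjoint_closedProj L).star_eq] at this

@[simp] theorem closedProj_mul_self (M : Submodule ℂ H) :
    closedProj M * closedProj M = closedProj M := closedProj_mul_of_le le_rfl

@[simp] theorem closedProj_bot : closedProj (⊥ : Submodule ℂ H) = 0 := by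
  ext x
  have := closedProj_apply_mem (M := (⊥ : Submodule ℂ H)) (by simp) x
  simpa using this

@[simp] theorem closedProj_top : closedProj (⊤ : Submodule ℂ H) = 1 := by
  ext x
  exact closedProj_eq_self (by simp)

theorem isSelfAdjoint_closedProj_sub (M L : Submodule ℂ H) :
    IsSelfAdjoint (closedProj L - closedProj M) :=
  (isSelfAdjoint_closedProj L).sub (isSelfAdjoint_closedProj M)

theorem closedProj_sub_mul_self {M L : Submodule ℂ H} (h : M ≤ L) :
    (closedProj L - closedProj M) * (closedProj L - closedProj M) =
      closedProj L - closedProj M := by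
  simp [mul_sub, sub_mul, closedProj_mul_of_le h, closedProj_mul_of_ge h]

/-- A self-adjoint idempotent is a contraction. -/
theorem norm_le_one_of_isSelfAdjoint_of_mul_self {T : H →L[ℂ] H} (h : IsSelfAdjoint T)
    (hT : T * T = T) : ‖T‖ ≤ 1 := by
  have h1 := CStarRing.norm_star_mul_self (x := T)
  rw [h.star_eq, hT] at h1
  by_contra! h2
  nlinarith

theorem norm_closedProj_sub_le {M L : Submodule ℂ H} (h : M ≤ L) :
    ‖closedProj L - closedProj M‖ ≤ 1 :=
  norm_le_one_of_isSelfAdjoint_of_mul_self (isSelfAdjoint_closedProj_sub M L)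
    (closedProj_sub_mul_self h)

theorem norm_one_sub_closedProj_le (M : Submodule ℂ H) : ‖1 - closedProj M‖ ≤ 1 := by
  have := norm_closedProj_sub_le (le_top : M ≤ ⊤)
  rwa [closedProj_top] at this

theorem norm_sq_add_norm_sq_one_sub_closedProj (M : Submodule ℂ H) (x : H) :
    ‖closedProj M x‖ ^ 2 + ‖(1 - closedProj M) x‖ ^ 2 = ‖x‖ ^ 2 := by
  have h := Submodule.norm_sq_eq_add_norm_sq_starProjection x M.topologicalClosure
  rw [Submodule.starProjection_orthogonal'] at h
  exact h.symm

end ClosedProjections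

/-! ### Compactness turns strong convergence into norm convergence -/

section CompactOperators

variable {H : Type*} [NormedAddCommGroup H] [InnerProductSpace ℂ H]

theorem IsCompactOperator.const_mul {K : H →L[ℂ] H} (hK : IsCompactOperator K) (T : H →L[ℂ] H) :
    IsCompactOperator (T * K : H →L[ℂ] H) :=
  hK.clm_comp T

theorem IsCompactOperator.mul_const {K : H →L[ℂ] H} (hK : IsCompactOperator K) (T : H →L[ℂ] H) :
    IsCompactOperator (K * T : H →L[ℂ] H) :=
  hK.comp_clm T

/-- A bounded family of operators that tends strongly to zero tends to zero in norm after
multiplication with a compact operator. -/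
theorem IsCompactOperator.tendsto_norm_mul {ι : Type*} {l : Filter ι} {D : H →L[ℂ] H}
    (hD : IsCompactOperator D) {F : ι → H →L[ℂ] H} (hF : ∀ i, ‖F i‖ ≤ 1)
    (h0 : ∀ x, Tendsto (fun i => F i x) l (𝓝 0)) :
    Tendsto (fun i => ‖F i * D‖) l (𝓝 0) := by
  rw [Metric.tendsto_nhds]
  intro ε hε
  obtain ⟨K, hK, hDK⟩ := hD.image_closedBall_subset_compact 1
  obtain ⟨t, -, htf, ht⟩ := hK.finite_cover_balls (e := ε / 4) (by positivity)
  have h1 : ∀ᶠ i in l, ∀ x ∈ t, ‖F i x‖ < ε / 4 := by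
    rw [eventually_all_finite htf]
    intro x _
    have := (Metric.tendsto_nhds.1 (h0 x)) (ε / 4) (by positivity)
    simpa using this
  filter_upwards [h1] with i hi
  have h2 : ‖F i * D‖ ≤ ε / 2 := by
    refine ContinuousLinearMap.opNorm_le_of_unit_norm (𝕜 := ℂ) (by positivity) fun x hx => ?_
    have hx' : D x ∈ K := hDK ⟨x, by simp [hx], rfl⟩
    obtain ⟨y, hy, hxy⟩ := Set.mem_iUnion₂.1 (ht hx')
    have h3 : F i (D x) = F i (D x - y) + F i y := by simp
    have h4 : ‖F i (D x - y)‖ ≤ 1 * ‖D x - y‖ := (F i).le_of_opNorm_le (hF i) _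
    rw [Metric.mem_ball, dist_eq_norm] at hxy
    have h5 := hi y hy
    calc ‖(F i * D) x‖ = ‖F i (D x - y) + F i y‖ := by rw [← h3]; rfl
      _ ≤ _ := norm_add_le _ _
      _ ≤ ε / 2 := by linarith
  simpa using by linarith

/-- The C*-identity `‖D F‖² = ‖F D* D F‖` reduces this to multiplication from the left, applied to
the compact operator `D* D`; compactness of `D*` is not needed. -/
theorem IsCompactOperator.tendsto_norm_mul_right [CompleteSpace H] {ι : Type*} {l : Filter ι}
    {D : H →L[ℂ] H} (hD : IsCompactOperator D) {F : ι → H →L[ℂ] H} (hF : ∀ i, ‖F i‖ ≤ 1)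
    (hs : ∀ i, IsSelfAdjoint (F i)) (h0 : ∀ x, Tendsto (fun i => F i x) l (𝓝 0)) :
    Tendsto (fun i => ‖D * F i‖) l (𝓝 0) := by
  have h1 : IsCompactOperator (star D * D) := hD.const_mul (star D)
  have h2 := (h1.tendsto_norm_mul hF h0).sqrt
  rw [Real.sqrt_zero] at h2
  refine squeeze_zero (fun _ => norm_nonneg _) (fun i => Real.le_sqrt_of_sq_le ?_) h2
  calc ‖D * F i‖ ^ 2 = ‖star (D * F i) * (D * F i)‖ := by
        rw [CStarRing.norm_star_mul_self, sq]
    _ = ‖(F i * (star D * D)) * F i‖ := by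
        rw [star_mul, (hs i).star_eq]; simp only [mul_assoc]
    _ ≤ ‖F i * (star D * D)‖ * 1 := (norm_mul_le _ _).trans (by gcongr; exact hF i)
    _ = _ := mul_one _

variable [CompleteSpace H]

theorem tendsto_closedProj_sub_sSup (S : Set (Submodule ℂ H)) (x : H) :
    Tendsto (fun b : S => (closedProj (sSup S).topologicalClosure - closedProj b.1) x) atTop
      (𝓝 0) := by
  have h := Submodule.starProjection_tendsto_closure_iSup (𝕜 := ℂ)
    (fun b : S => b.1.topologicalClosure) (fun a b hab => Submodule.topologicalClosure_mono hab) x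
  have h2 : (⨆ b : S, b.1.topologicalClosure).topologicalClosure =
      (sSup S).topologicalClosure.topologicalClosure := by
    refine le_antisymm ?_ ?_
    · refine Submodule.topologicalClosure_mono (iSup_le fun b => Submodule.topologicalClosure_mono
        (le_sSup b.2))
    · rw [(Submodule.isClosed_topologicalClosure _).submodule_topologicalClosure_eq]
      refine Submodule.topologicalClosure_mono (sSup_le fun b hb => ?_)
      exact b.le_topologicalClosure.trans (le_iSup (fun b : S => b.1.topologicalClosure) ⟨b, hb⟩)
  have h3 := (tendsto_const_nhds (x := closedProj (sSup S).topologicalClosure x)).sub h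
  simp only [h2] at h3
  simpa [closedProj] using h3

/-- Passing to orthogonal complements turns the decreasing net into an increasing one; the order
dual supplies the matching `atTop`. -/
theorem tendsto_closedProj_sub_sInf {S : Set (Submodule ℂ H)}
    (hc : ∀ M ∈ S, IsClosed (M : Set H)) (x : H) :
    Tendsto (fun b : Sᵒᵈ => (closedProj (OrderDual.ofDual b).1 - closedProj (sInf S)) x) atTop
      (𝓝 0) := by
  have h := Submodule.starProjection_tendsto_closure_iSup (𝕜 := ℂ)
    (fun b : Sᵒᵈ => ((OrderDual.ofDual b).1.topologicalClosure)ᗮ)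
    (fun a b hab => Submodule.orthogonal_le (Submodule.topologicalClosure_mono hab)) x
  have h2 : (⨆ b : Sᵒᵈ, ((OrderDual.ofDual b).1.topologicalClosure)ᗮ).topologicalClosure =
      ((sInf S).topologicalClosure)ᗮ := by
    rw [← Submodule.orthogonal_orthogonal_eq_closure, ← Submodule.iInf_orthogonal]
    congr 1
    have h4 : IsClosed ((sInf S : Submodule ℂ H) : Set H) := by
      rw [Submodule.coe_sInf]
      exact isClosed_biInter hc
    rw [h4.submodule_topologicalClosure_eq, sInf_eq_iInf']
    refine Equiv.iInf_congr OrderDual.ofDual fun b => ?_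
    rw [Submodule.orthogonal_orthogonal_eq_closure,
      (Submodule.isClosed_topologicalClosure _).submodule_topologicalClosure_eq,
      (hc _ (OrderDual.ofDual b).2).submodule_topologicalClosure_eq]
  have h3 := (tendsto_const_nhds (x := x - closedProj (sInf S) x)).sub h
  simp only [h2, Submodule.starProjection_orthogonal'] at h3
  simpa [closedProj] using h3

end CompactOperators

/-! ### Parrott's completion lemma -/

section Parrott

variable {H : Type*} [NormedAddCommGroup H] [InnerProductSpace ℂ H] [CompleteSpace H]

/-- The column `(A*, B*)` is the adjoint of the row `(A B)`, so has the same norm: test the row on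
the vector `(A* y, B* y)`. -/
theorem norm_sq_adjoint_add_le_of_row {A B : H →L[ℂ] H} {c : ℝ}
    (hrow : ∀ u v, ‖A u + B v‖ ^ 2 ≤ c ^ 2 * (‖u‖ ^ 2 + ‖v‖ ^ 2)) (y : H) :
    ‖star A y‖ ^ 2 + ‖star B y‖ ^ 2 ≤ c ^ 2 * ‖y‖ ^ 2 := by
  set s := ‖star A y‖ ^ 2 + ‖star B y‖ ^ 2 with hs
  have h1 := hrow (star A y) (star B y)
  have h2 : s = (inner ℂ y (A (star A y) + B (star B y))).re := by
    rw [inner_add_right, ← ContinuousLinearMap.adjoint_inner_left A,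
      ← ContinuousLinearMap.adjoint_inner_left B]
    simp only [ContinuousLinearMap.star_eq_adjoint, Complex.add_re] at hs ⊢
    rw [hs, ← inner_self_eq_norm_sq (𝕜 := ℂ), ← inner_self_eq_norm_sq (𝕜 := ℂ)]
    rfl
  have h3 : s ≤ ‖y‖ * ‖A (star A y) + B (star B y)‖ := by
    rw [h2]
    exact (Complex.re_le_norm _).trans (norm_inner_le_norm _ _)
  rw [← hs] at h1
  have hs0 : 0 ≤ s := by positivity
  rcases hs0.eq_or_lt with h | h
  · rw [← h]; positivity
  have h4 : s ^ 2 ≤ ‖y‖ ^ 2 * (c ^ 2 * s) := by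
    calc s ^ 2 ≤ (‖y‖ * ‖A (star A y) + B (star B y)‖) ^ 2 := by gcongr
      _ = ‖y‖ ^ 2 * ‖A (star A y) + B (star B y)‖ ^ 2 := by ring
      _ ≤ _ := by gcongr
  nlinarith

/-- Parrott's lemma with an explicit solution: a row contraction `(A B)` and a column contraction
`(A C)` with `‖A‖ < 1` have a common contractive `2 × 2` completion, with new
entry in `C * B(H) * B`. -/
theorem exists_contractive_completion {A B C : H →L[ℂ] H} (hA : ‖A‖ < 1)
    (hrow : ∀ u v, ‖A u + B v‖ ^ 2 ≤ ‖u‖ ^ 2 + ‖v‖ ^ 2)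
    (hcol : ∀ u, ‖A u‖ ^ 2 + ‖C u‖ ^ 2 ≤ ‖u‖ ^ 2) :
    ∃ Y : H →L[ℂ] H, ∀ u v,
      ‖A u + B v‖ ^ 2 + ‖C u + (C * Y * B) v‖ ^ 2 ≤ ‖u‖ ^ 2 + ‖v‖ ^ 2 := by
  have hAA : ‖star A * A‖ < 1 := by
    rw [CStarRing.norm_star_mul_self]
    nlinarith [norm_nonneg A]
  obtain ⟨G, hG⟩ : ∃ G : H →L[ℂ] H, (1 - star A * A) * G = 1 :=
    ⟨_, (Units.oneSub (star A * A) hAA).mul_inv⟩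
  have hG' : G - star A * A * G = 1 := by rw [← hG]; noncomm_ring
  -- The new entry is `-C (1 - A*A)⁻¹ A* B`. With `w` and `y` as below, `u = w + A* y`, the first
  -- row gives `A w + y` and the second gives `C w`. The cross terms agree, so the claim splits into
  -- `‖A w‖² + ‖C w‖² ≤ ‖w‖²` and `‖y‖² - ‖A* y‖² ≤ ‖v‖²`.
  refine ⟨-(G * star A), fun u v => ?_⟩
  set w := u - G (star A (B v)) with hw
  set y := B v + A (G (star A (B v))) with hy
  have hGx : ∀ x, G x - star A (A (G x)) = x := fun x => by
    simpa using congrArg (fun T : H →L[ℂ] H => T x) hG'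
  have hCw : C u + (C * (-(G * star A)) * B) v = C w := by simp [hw, sub_eq_add_neg]
  have hyA : y - A (star A y) = B v := by
    have := congrArg A (hGx (star A (B v)))
    simp only [map_sub] at this
    simp only [hy, map_add]
    rw [← this]; abel
  have hAu : A u + B v = A w + y := by simp only [hw, hy, map_sub]; abel
  have hAw : star A y = G (star A (B v)) := by
    have := hGx (star A (B v))
    simp only [hy, map_add]
    nth_rewrite 1 [← this]; abel
  have hu : u = w + star A y := by rw [hAw, hw]; abel
  -- bound for the vector `y`
  have hrow' := norm_sq_adjoint_add_le_of_row (c := 1) (by simpa using hrow) y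
  have e1 : (inner ℂ y (B v)).re = ‖y‖ ^ 2 - ‖star A y‖ ^ 2 := by
    rw [← hyA, inner_sub_right, ← ContinuousLinearMap.adjoint_inner_left,
      ← inner_self_eq_norm_sq (𝕜 := ℂ), ← inner_self_eq_norm_sq (𝕜 := ℂ)]
    simp [ContinuousLinearMap.star_eq_adjoint]
  have e2 : (inner ℂ y (B v)).re ≤ ‖star B y‖ * ‖v‖ := by
    rw [← ContinuousLinearMap.adjoint_inner_left]
    exact (Complex.re_le_norm _).trans (norm_inner_le_norm _ _)
  have e3 : ‖y‖ ^ 2 - ‖star A y‖ ^ 2 ≤ ‖v‖ ^ 2 := by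
    have := norm_nonneg v
    have := norm_nonneg (star B y)
    nlinarith [sq_nonneg (‖star B y‖ - ‖v‖)]
  have e4 : ‖A w + y‖ ^ 2 = ‖A w‖ ^ 2 + 2 * (inner ℂ (A w) y).re + ‖y‖ ^ 2 :=
    norm_add_sq (𝕜 := ℂ) (A w) y
  have e5 : ‖w + star A y‖ ^ 2 = ‖w‖ ^ 2 + 2 * (inner ℂ w (star A y)).re + ‖star A y‖ ^ 2 :=
    norm_add_sq (𝕜 := ℂ) w (star A y)
  have e6 : inner ℂ w (star A y) = inner ℂ (A w) y :=
    ContinuousLinearMap.adjoint_inner_right A w y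
  have e7 := hcol w
  rw [← hu, e6] at e5
  rw [hCw, hAu, e4, e5]
  linarith

end Parrott

theorem nestAlgebra_le_quasiTriangularAlgebra {H : Type*} [NormedAddCommGroup H]
    [InnerProductSpace ℂ H] (N : Nest H) :
    nestAlgebra N ≤ quasiTriangularAlgebra N := fun T hT =>
  ⟨T, hT, 0, isCompactOperator_zero, by simp⟩

/-! ### Nest algebras described by corners below the diagonal -/

section NestProjections

variable {H : Type*} [NormedAddCommGroup H] [InnerProductSpace ℂ H] [CompleteSpace H]

theorem Nest.closedProj_mem (N : Nest H) {M : Submodule ℂ H} (hM : M ∈ N.carrier) :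
    closedProj M ∈ nestAlgebra N := by
  intro L hL x hx
  rcases N.chain M hM L hL with h | h
  · exact h (closedProj_apply_mem (N.isClosed_of_mem M hM) x)
  · rwa [closedProj_eq_self (h hx)]

theorem mul_closedProj_of_mem_nestAlgebra {N : Nest H} {T : H →L[ℂ] H} (hT : T ∈ nestAlgebra N)
    {M : Submodule ℂ H} (hM : M ∈ N.carrier) :
    (1 - closedProj M) * T * closedProj M = 0 := by
  ext x
  have h := hT M hM _ (closedProj_apply_mem (N.isClosed_of_mem M hM) x)
  simp [closedProj_eq_self h]

theorem mem_nestAlgebra_of_mul_closedProj {N : Nest H} {T : H →L[ℂ] H}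
    (h : ∀ M ∈ N.carrier, (1 - closedProj M) * T * closedProj M = 0) : T ∈ nestAlgebra N := by
  intro M hM x hx
  have h1 := congrArg (fun S : H →L[ℂ] H => S x) (h M hM)
  simp only [mul_apply_eq_comp, closedProj_eq_self hx, sub_apply,
    one_apply_eq_self, zero_apply, sub_eq_zero] at h1
  rw [h1]
  exact closedProj_apply_mem (N.isClosed_of_mem M hM) _

theorem isClosed_nestAlgebra (N : Nest H) : IsClosed (nestAlgebra N : Set (H →L[ℂ] H)) := by
  have : (nestAlgebra N : Set (H →L[ℂ] H)) =
      ⋂ M ∈ N.carrier, {T | (1 - closedProj M) * T * closedProj M = 0} := by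
    ext T
    simp only [Set.mem_iInter, Set.mem_ofPred_eq, SetLike.mem_coe]
    exact ⟨fun h M hM => mul_closedProj_of_mem_nestAlgebra h hM,
      mem_nestAlgebra_of_mul_closedProj⟩
  rw [this]
  refine isClosed_biInter fun M _ => isClosed_eq (by fun_prop) continuous_const

/-- The corner map annihilates the nest algebra, so it sends the quasi-triangular algebra to compact
operators; these form a norm closed set, so the closure follows. -/
theorem isCompactOperator_of_mem_closure_quasiTriangularAlgebra {N : Nest H} {X : H →L[ℂ] H}
    (hX : X ∈ closure (quasiTriangularAlgebra N : Set (H →L[ℂ] H)))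
    {M : Submodule ℂ H} (hM : M ∈ N.carrier) :
    IsCompactOperator ((1 - closedProj M) * X * closedProj M : H →L[ℂ] H) := by
  have h : (1 - closedProj M) * X * closedProj M ∈
      closure {T : H →L[ℂ] H | IsCompactOperator T} := by
    refine map_mem_closure (f := fun X => (1 - closedProj M) * X * closedProj M) (by fun_prop) hX ?_
    rintro _ ⟨T, hT, K, hK, rfl⟩
    have : (1 - closedProj M) * (T + K) * closedProj M = (1 - closedProj M) * K * closedProj M := by
      rw [mul_add, add_mul, mul_closedProj_of_mem_nestAlgebra hT hM, zero_add]
    simp only [Set.mem_ofPred_eq, this]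
    exact (hK.const_mul _).mul_const _
  rw [isClosed_setOfPred_isCompactOperator.closure_eq] at h
  exact h

end NestProjections

/-! ### Filling in the corners along a finite chain of the nest -/

section ColumnFilling

variable {H : Type*} [NormedAddCommGroup H] [InnerProductSpace ℂ H] [CompleteSpace H]

/-- The interval `[a, b]` of the nest is a step for `R` and `η` if every element of the nest in
between cuts the diagonal block of `R` with a lower left corner of norm at most `η`. -/
def IsNestStep (N : Nest H) (R : H →L[ℂ] H) (η : ℝ) (a b : Submodule ℂ H) : Prop :=
  a ∈ N.carrier ∧ b ∈ N.carrier ∧ a ≤ b ∧ ∀ e ∈ N.carrier, a ≤ e → e ≤ b →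
    ‖(closedProj b - closedProj e) * R * (closedProj e - closedProj a)‖ ≤ η

theorem mem_of_reflTransGen_isNestStep {N : Nest H} {R : H →L[ℂ] H} {η : ℝ} {b : Submodule ℂ H}
    (h : Relation.ReflTransGen (IsNestStep N R η) ⊥ b) : b ∈ N.carrier := by
  cases h with
  | refl => exact N.bot_mem
  | tail _ h => exact h.2.1

theorem norm_sq_closedProj_add_sub {a b : Submodule ℂ H} (hab : a ≤ b) (u v : H) :
    ‖closedProj a u + (closedProj b - closedProj a) v‖ ^ 2 =
      ‖closedProj a u‖ ^ 2 + ‖(closedProj b - closedProj a) v‖ ^ 2 := by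
  have h1 : ∀ x, closedProj a (closedProj a x) = closedProj a x := fun x =>
    congrArg (fun T : H →L[ℂ] H => T x) (closedProj_mul_self a)
  have h2 : ∀ x, closedProj a (closedProj b x) = closedProj a x := fun x =>
    congrArg (fun T : H →L[ℂ] H => T x) (closedProj_mul_of_le hab)
  rw [← norm_sq_add_norm_sq_one_sub_closedProj a]
  simp [h1, h2]

theorem norm_sq_closedProj_add_norm_sq_sub_le {a b : Submodule ℂ H} (hab : a ≤ b) (x : H) :
    ‖closedProj a x‖ ^ 2 + ‖(closedProj b - closedProj a) x‖ ^ 2 ≤ ‖x‖ ^ 2 := by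
  rw [← norm_sq_closedProj_add_sub hab]
  have := norm_closedProj_apply_le b x
  simp only [sub_apply, add_sub_cancel]
  gcongr

/-- One inductive step: `K` handles the columns up to `a`, and `X` adds the columns between `a` and
`b`. Below `a` the new column is prescribed to be `B`; the entry above `a` is free and is chosen by
Parrott's lemma so that the norm stays at most 1. That entry has the form `C Y B`, so it inherits
compactness from `B`. -/
theorem exists_compact_extension {a b : Submodule ℂ H} (hab : a ≤ b) {R K : H →L[ℂ] H}
    (hb : IsCompactOperator ((1 - closedProj b) * R * closedProj b : H →L[ℂ] H))
    (ha' : ‖(1 - closedProj a) * R * closedProj a‖ ≤ 1 / 3)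
    (hb' : ‖(1 - closedProj b) * R * closedProj b‖ ≤ 1 / 3)
    (hKa : K * closedProj a = K) (hK1 : ‖K‖ ≤ 1)
    (hKR : (1 - closedProj a) * K = (1 - closedProj a) * R * closedProj a) :
    ∃ X : H →L[ℂ] H, IsCompactOperator X ∧ X * closedProj a = 0 ∧ X * closedProj b = X ∧
      (1 - closedProj a) * X = (1 - closedProj b) * R * (closedProj b - closedProj a) ∧
      ‖K + X‖ ≤ 1 := by
  set p := closedProj a with hp
  set q := closedProj b with hq
  have hpp : p * p = p := closedProj_mul_self a
  have hqq : q * q = q := closedProj_mul_self b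
  have hpq : p * q = p := closedProj_mul_of_le hab
  have hqp : q * p = p := closedProj_mul_of_ge hab
  have hpp' : ∀ X, p * (p * X) = p * X := fun X => by rw [← mul_assoc, hpp]
  have hpq' : ∀ X, p * (q * X) = p * X := fun X => by rw [← mul_assoc, hpq]
  have hqp' : ∀ X, q * (p * X) = p * X := fun X => by rw [← mul_assoc, hqp]
  set A := (1 - p) * R * p with hA
  set B := (1 - q) * R * (q - p) with hB
  set C := p * K with hC
  have hAp : A * p = A := by simp only [hA, mul_assoc, hpp]
  have hBq : B * (q - p) = B := by
    simp only [hB, mul_assoc]; congr 2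
    simp [mul_sub, sub_mul, hqq, hpq, hqp, hpp]
  have hBp : B * p = 0 := by simp [hB, mul_assoc, sub_mul, hqp, hpp]
  have hCp : C * p = C := by simp only [hC, mul_assoc, hKa]
  have hAq : A * (q - p) = 0 := by simp [hA, mul_assoc, mul_sub, hpq, hpp]
  -- The row is the corner at `b` plus a compression of the corner at `a`, so its norm is at most
  -- 1/3 + 1/3. This bound does not involve `K`, so the induction does not accumulate constants.
  have hT : ‖A + B‖ ≤ 1 := by
    have e : A + B = (1 - q) * R * q + (q - p) * ((1 - p) * R * p) := by
      simp only [hA, hB, mul_sub, sub_mul, mul_assoc, hpp', hqp', one_mul]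
      abel
    rw [e]
    have h1 := norm_add_le ((1 - q) * R * q) ((q - p) * ((1 - p) * R * p))
    have h2 : ‖(q - p) * ((1 - p) * R * p)‖ ≤ 1 * (1 / 3) :=
      (norm_mul_le _ _).trans (by
        have := norm_closedProj_sub_le hab
        gcongr)
    linarith
  have hrow : ∀ u v, ‖A u + B v‖ ^ 2 ≤ ‖u‖ ^ 2 + ‖v‖ ^ 2 := by
    intro u v
    have e : A u + B v = (A + B) (p u + (q - p) v) := by
      have h1 := congrArg (fun T : H →L[ℂ] H => T u) hAp
      have h2 := congrArg (fun T : H →L[ℂ] H => T v) hBq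
      have h3 := congrArg (fun T : H →L[ℂ] H => T u) hBp
      have h4 := congrArg (fun T : H →L[ℂ] H => T v) hAq
      simp only [mul_apply_eq_comp, zero_apply] at h1 h2 h3 h4
      simp only [map_add, add_apply, h1, h2, h3, h4]
      abel
    have h5 := (A + B).le_of_opNorm_le hT (p u + (q - p) v)
    rw [one_mul] at h5
    rw [e]
    have h6 := norm_closedProj_apply_le a u
    have h7 := (q - p).le_of_opNorm_le (norm_closedProj_sub_le hab) v
    rw [one_mul] at h7
    calc _ ≤ ‖p u + (q - p) v‖ ^ 2 := by gcongr
      _ = ‖p u‖ ^ 2 + ‖(q - p) v‖ ^ 2 := norm_sq_closedProj_add_sub hab u v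
      _ ≤ _ := by gcongr
  have hcol : ∀ u, ‖A u‖ ^ 2 + ‖C u‖ ^ 2 ≤ ‖u‖ ^ 2 := by
    intro u
    have h1 := norm_sq_add_norm_sq_one_sub_closedProj a (K u)
    have h2 := congrArg (fun T : H →L[ℂ] H => T u) hKR
    rw [← hp] at h1
    have h3 := K.le_of_opNorm_le hK1 u
    rw [one_mul] at h3
    have h4 : ‖K u‖ ^ 2 ≤ ‖u‖ ^ 2 := by gcongr
    have h5 : A u = (1 - p) (K u) := by rw [← hKR]; rfl
    have h6 : C u = p (K u) := rfl
    rw [h5, h6]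
    linarith
  obtain ⟨Y, hY⟩ := exists_contractive_completion (by linarith) hrow hcol
  have hBcomp : IsCompactOperator B := by
    have : B = (1 - q) * R * q * (q - p) := by
      simp only [hB, mul_assoc, mul_sub, hqq, hqp]
    rw [this]
    exact hb.mul_const _
  have hpB : p * B = 0 := by simp [hB, sub_mul, mul_sub, mul_assoc, hpq']
  refine ⟨B + C * Y * B, hBcomp.add (hBcomp.const_mul (C * Y)), ?_, ?_, ?_, ?_⟩
  · rw [add_mul, mul_assoc _ B, hBp]; simp
  · have hBq' : B * q = B := by
      have := hBq
      rwa [mul_sub, hBp, sub_zero] at this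
    rw [add_mul, mul_assoc _ B, hBq']
  · have : (1 - p) * C = 0 := by simp [hC, sub_mul, hpp']
    rw [mul_add, mul_assoc C, ← mul_assoc _ C, this, zero_mul, add_zero, sub_mul, one_mul, hpB,
      sub_zero]
  · refine ContinuousLinearMap.opNorm_le_bound _ zero_le_one fun x => ?_
    rw [one_mul]
    refine le_of_sq_le_sq ?_ (norm_nonneg x)
    rw [← norm_sq_add_norm_sq_one_sub_closedProj a, ← hp]
    have e1 : p * (K + (B + C * Y * B)) = C * p + C * Y * B * (q - p) := by
      rw [hCp, mul_assoc _ B, hBq, mul_add, mul_add, hpB, hC]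
      simp only [mul_assoc, hpp', zero_add]
    have e2 : (1 - p) * (K + (B + C * Y * B)) = A * p + B * (q - p) := by
      have : (1 - p) * C = 0 := by simp [hC, sub_mul, hpp']
      rw [hAp, hBq, mul_add, hKR, mul_add, mul_assoc C, ← mul_assoc _ C, this, zero_mul, add_zero,
        sub_mul 1 p B, one_mul, hpB, sub_zero]
    have e1' := congrArg (fun T : H →L[ℂ] H => T x) e1
    have e2' := congrArg (fun T : H →L[ℂ] H => T x) e2
    have h8 := hY (p x) ((q - p) x)
    have h9 := norm_sq_closedProj_add_norm_sq_sub_le hab x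
    simp only [mul_apply_eq_comp, add_apply] at e1' e2' h8 ⊢
    rw [e1', e2']
    linarith

/-- Along a finite chain of steps an operator has a compact contractive approximation modulo the
nest algebra. -/
theorem exists_compact_of_reflTransGen {N : Nest H} {R : H →L[ℂ] H} {η : ℝ} (hη : 0 ≤ η)
    (hcomp : ∀ e ∈ N.carrier, IsCompactOperator ((1 - closedProj e) * R * closedProj e : H →L[ℂ] H))
    (hnorm : ∀ e ∈ N.carrier, ‖(1 - closedProj e) * R * closedProj e‖ ≤ 1 / 3)
    {b : Submodule ℂ H} (h : Relation.ReflTransGen (IsNestStep N R η) ⊥ b) :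
    ∃ K : H →L[ℂ] H, IsCompactOperator K ∧ K * closedProj b = K ∧ ‖K‖ ≤ 1 ∧
      (1 - closedProj b) * K = (1 - closedProj b) * R * closedProj b ∧
      ∀ e ∈ N.carrier, e ≤ b → ‖(1 - closedProj e) * (R - K) * closedProj e‖ ≤ η := by
  induction h with
  | refl =>
    refine ⟨0, isCompactOperator_zero, by simp, by simp, by simp, fun e _ he => ?_⟩
    rw [le_bot_iff.1 he]
    simpa using hη
  | @tail a b _ hab ih =>
    obtain ⟨K, hK, hKa, hK1, hKR, hKe⟩ := ih
    obtain ⟨ha, hb, hab, hstep⟩ := hab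
    obtain ⟨X, hX, hXa, hXb, hXR, hX1⟩ := exists_compact_extension hab (hcomp b hb) (hnorm a ha)
      (hnorm b hb) hKa hK1 hKR
    have hqp := closedProj_mul_of_ge hab
    have hpq := closedProj_mul_of_le hab
    -- Below any `e ≥ a`, the operator `K + X` is determined by `R`, whatever the free entries are.
    -- Subtracting it from `R` leaves, in the corner at `e ≤ b`, exactly the block that the step
    -- condition bounds by `η`.
    have key' : ∀ e : Submodule ℂ H, a ≤ e →
        (1 - closedProj e) * (1 - closedProj a) = 1 - closedProj e := by
      intro e hae
      simp [mul_sub, sub_mul, closedProj_mul_of_ge hae]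
    have key : ∀ e : Submodule ℂ H, a ≤ e → (1 - closedProj e) * (K + X) = (1 - closedProj e) *
        (R * closedProj a + (1 - closedProj b) * R * (closedProj b - closedProj a)) := by
      intro e hae
      rw [← key' e hae, mul_assoc, mul_add, hKR, hXR]
      simp only [mul_add, ← mul_assoc, key' e hae]
    refine ⟨K + X, hK.add hX, ?_, hX1, ?_, fun e he heb => ?_⟩
    · rw [add_mul, hXb, ← hKa, mul_assoc, hpq]
    · have : (1 - closedProj b) * (1 - closedProj b) = 1 - closedProj b := by
        simp [mul_sub, sub_mul]
      rw [key b hab, mul_add, ← mul_assoc, ← mul_assoc, ← mul_assoc, this]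
      noncomm_ring
    -- For `e ≤ a` the new columns vanish on `e`, and the earlier estimate is untouched.
    · rcases N.chain e he a ha with hea | hae
      · have : X * closedProj e = 0 := by
          rw [← closedProj_mul_of_ge hea, ← mul_assoc, hXa, zero_mul]
        have e1 : (1 - closedProj e) * (R - (K + X)) * closedProj e =
            (1 - closedProj e) * (R - K) * closedProj e := by
          rw [← sub_sub, mul_assoc, sub_mul _ X, this, sub_zero, mul_assoc]
        rw [e1]
        exact hKe e he hea
      · have e1 : (1 - closedProj e) * (R - (K + X)) * closedProj e =
            (closedProj b - closedProj e) * R * (closedProj e - closedProj a) := by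
          have h3 : (1 - closedProj e) * (1 - closedProj b) = 1 - closedProj b := by
            simp [mul_sub, sub_mul, closedProj_mul_of_le heb]
          rw [mul_sub, key e hae, mul_add, ← mul_assoc, ← mul_assoc, ← mul_assoc, h3]
          simp only [mul_sub, sub_mul, add_mul, mul_assoc, closedProj_mul_of_le hae,
            closedProj_mul_of_ge heb, one_mul]
          abel
        rw [e1]
        exact hstep e he hae heb

end ColumnFilling

/-! ### Gliding hump: no infinite sequence of disjoint large blocks -/

section GlidingHump

variable {H : Type*} [NormedAddCommGroup H] [InnerProductSpace ℂ H] [CompleteSpace H]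

/-- Pairwise orthogonal projections tend strongly to zero. -/
theorem tendsto_apply_zero_of_pairwise_orthogonal {f : ℕ → H →L[ℂ] H}
    (hs : ∀ k, IsSelfAdjoint (f k)) (hf : ∀ k, f k * f k = f k)
    (ho : ∀ j k, j ≠ k → f j * f k = 0) (x : H) : Tendsto (fun k => f k x) atTop (𝓝 0) := by
  have h1 : ∀ s : Finset ℕ, ∑ k ∈ s, ‖f k x‖ ^ 2 ≤ ‖x‖ ^ 2 := by
    intro s
    -- Bessel's inequality: a finite sum of pairwise orthogonal projections is a projection, hence a
    -- contraction.
    set g := ∑ k ∈ s, f k with hg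
    have hgs : IsSelfAdjoint g := by
      rw [IsSelfAdjoint, hg, star_sum]
      exact Finset.sum_congr rfl fun k _ => (hs k).star_eq
    have hgg : g * g = g := by
      rw [hg, Finset.sum_mul_sum]
      refine Finset.sum_congr rfl fun j hj => ?_
      rw [Finset.sum_eq_single j (fun k _ hk => ho j k hk.symm) (fun h => absurd hj h), hf]
    have hg1 := norm_le_one_of_isSelfAdjoint_of_mul_self hgs hgg
    have h2 : ∀ k, ‖f k x‖ ^ 2 = (inner ℂ x (f k x)).re := by
      intro k
      have h3 : inner ℂ (f k x) (f k x) = inner ℂ x (f k x) := by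
        rw [← ContinuousLinearMap.adjoint_inner_right, ← ContinuousLinearMap.star_eq_adjoint,
          (hs k).star_eq]
        exact congrArg (fun T : H →L[ℂ] H => inner ℂ x (T x)) (hf k)
      rw [← h3]
      exact (inner_self_eq_norm_sq (𝕜 := ℂ) (f k x)).symm
    have h4 : ∑ k ∈ s, ‖f k x‖ ^ 2 = (inner ℂ x (g x)).re := by
      rw [hg, sum_apply, inner_sum, Complex.re_sum]
      exact Finset.sum_congr rfl fun k _ => h2 k
    rw [h4]
    have h5 := g.le_of_opNorm_le hg1 x
    calc (inner ℂ x (g x)).re ≤ ‖x‖ * ‖g x‖ :=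
          (Complex.re_le_norm _).trans (norm_inner_le_norm _ _)
      _ ≤ ‖x‖ * (1 * ‖x‖) := by gcongr
      _ = _ := by ring
  have h6 : Summable fun k => ‖f k x‖ ^ 2 :=
    summable_of_sum_le (fun _ => by positivity) h1
  have h7 := h6.tendsto_atTop_zero.sqrt
  rw [Real.sqrt_zero] at h7
  rw [tendsto_zero_iff_norm_tendsto_zero]
  simpa using h7

/-- Nest projections preserve each `q k ⊖ p k`, hence the closure of their span; a self-adjoint
operator leaving a closed subspace invariant commutes with its projection. -/
theorem Nest.closedProj_commute (N : Nest H) {M : Submodule ℂ H} (hM : M ∈ N.carrier)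
    {ι : Type*} {p q : ι → Submodule ℂ H} (hp : ∀ k, p k ∈ N.carrier) (hq : ∀ k, q k ∈ N.carrier) :
    closedProj (⨆ k, q k ⊓ (p k)ᗮ) * closedProj M =
      closedProj M * closedProj (⨆ k, q k ⊓ (p k)ᗮ) := by
  set V := ⨆ k, q k ⊓ (p k)ᗮ with hV
  have h1 : V ≤ V.comap (closedProj M : H →L[ℂ] H).toLinearMap := by
    refine iSup_le fun k v hv => ?_
    refine Submodule.mem_iSup_of_mem (p := fun k => q k ⊓ (p k)ᗮ) k ⟨?_, ?_⟩
    · exact N.closedProj_mem hM _ (hq k) v hv.1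
    · intro z hz
      change inner ℂ z (closedProj M v) = 0
      rw [← inner_closedProj_left]
      exact hv.2 _ (N.closedProj_mem hM _ (hp k) z hz)
  have h2 : closedProj V * closedProj M * closedProj V = closedProj M * closedProj V := by
    ext x
    refine Submodule.starProjection_eq_self_iff.2 ?_
    exact map_mem_closure (closedProj M).continuous
      (V.topologicalClosure.starProjection_apply_mem x) h1
  have h3 := congrArg star h2
  simp only [star_mul, (isSelfAdjoint_closedProj _).star_eq] at h3
  rw [← h3, ← mul_assoc, h2]

/-- An operator that derives the nest algebra into the closure of the quasi-triangular algebra has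
no sequence of blocks of large norm below the diagonal in disjoint intervals of the nest. -/
theorem false_of_disjoint_blocks {N : Nest H} {R : H →L[ℂ] H}
    (hR : ∀ A ∈ nestAlgebra N,
      R * A - A * R ∈ closure (quasiTriangularAlgebra N : Set (H →L[ℂ] H)))
    {η : ℝ} (hη : 0 < η) {p q r : ℕ → Submodule ℂ H} (hp : ∀ k, p k ∈ N.carrier)
    (hq : ∀ k, q k ∈ N.carrier) (hr : ∀ k, r k ∈ N.carrier) (hpq : ∀ k, p k ≤ q k)
    (hqr : ∀ k, q k ≤ r k) (hd : ∀ j k, j ≠ k → r j ≤ p k ∨ r k ≤ p j)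
    (hlarge : ∀ k, η < ‖(closedProj (r k) - closedProj (q k)) * R *
      (closedProj (q k) - closedProj (p k))‖) : False := by
  -- The projection `A` onto the closure of `V` is the test element: it fixes the ranges of all `h
  -- k` and is annihilated by all `f k`, so `f k (R A - A R) h k = f k R h k` for every `k` at once.
  set V := ⨆ k, q k ⊓ (p k)ᗮ with hV
  set f : ℕ → H →L[ℂ] H := fun k => closedProj (r k) - closedProj (q k) with hf
  set h : ℕ → H →L[ℂ] H := fun k => closedProj (q k) - closedProj (p k) with hh
  have hAmem : closedProj V ∈ nestAlgebra N := by
    intro M hM x hx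
    have h1 := congrArg (fun T : H →L[ℂ] H => T x) (N.closedProj_commute hM hp hq)
    simp only [mul_apply_eq_comp, closedProj_eq_self hx] at h1
    rw [h1]
    exact closedProj_apply_mem (N.isClosed_of_mem M hM) _
  have hAh : ∀ k, closedProj V * h k = h k := by
    intro k
    ext x
    refine closedProj_eq_self (Submodule.mem_iSup_of_mem (p := fun k => q k ⊓ (p k)ᗮ) k ⟨?_, ?_⟩)
    · exact (q k).sub_mem (closedProj_apply_mem (N.isClosed_of_mem _ (hq k)) x)
        (hpq k (closedProj_apply_mem (N.isClosed_of_mem _ (hp k)) x))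
    · intro z hz
      change inner ℂ z (closedProj (q k) x - closedProj (p k) x) = 0
      simp only [inner_sub_right, ← inner_closedProj_left, closedProj_eq_self hz,
        closedProj_eq_self (hpq k hz), sub_self]
  have hzero : ∀ {L : Submodule ℂ H} {v : H}, v ∈ Lᗮ → L ∈ N.carrier → closedProj L v = 0 := by
    intro L v hv hL
    rw [← inner_self_eq_zero (𝕜 := ℂ), ← inner_closedProj_left]
    exact hv _ (closedProj_apply_mem (N.isClosed_of_mem L hL) _)
  have hfA : ∀ k, f k * closedProj V = 0 := by
    intro k
    have h1 : V ≤ (f k).toLinearMap.ker := by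
      refine iSup_le fun j v hv => ?_
      rw [LinearMap.mem_ker]
      change closedProj (r k) v - closedProj (q k) v = 0
      have h2 : j = k ∨ r j ≤ p k ∨ r k ≤ p j := by
        by_cases hjk : j = k
        · exact Or.inl hjk
        · exact Or.inr (hd j k hjk)
      rcases h2 with rfl | h2 | h2
      · rw [closedProj_eq_self hv.1, closedProj_eq_self (hqr j hv.1), sub_self]
      · have h3 := h2 (hqr j hv.1)
        rw [closedProj_eq_self (hpq k h3), closedProj_eq_self (hqr k (hpq k h3)), sub_self]
      · have h3 := Submodule.orthogonal_le h2 hv.2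
        rw [hzero h3 (hr k), hzero (Submodule.orthogonal_le (hqr k) h3) (hq k), sub_self]
    ext x
    have h4 : V.topologicalClosure ≤ (f k).toLinearMap.ker :=
      V.topologicalClosure_minimal h1 (f k).isClosed_ker
    exact h4 (V.topologicalClosure.starProjection_apply_mem x)
  -- Replace the commutator by `T + K` up to `η / 2`. The triangular part has no block `f k T h k`,
  -- and `‖f k K‖` tends to zero, so some block of `R` has norm below `η`.
  obtain ⟨Y, ⟨T, hT, K, hK, rfl⟩, hY⟩ := Metric.mem_closure_iff.1 (hR _ hAmem) (η / 2) (half_pos hη)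
  rw [dist_eq_norm] at hY
  have hfs : ∀ k, IsSelfAdjoint (f k) := fun k => isSelfAdjoint_closedProj_sub _ _
  have hf1 : ∀ k, ‖f k‖ ≤ 1 := fun k => norm_closedProj_sub_le (hqr k)
  have hh1 : ∀ k, ‖h k‖ ≤ 1 := fun k => norm_closedProj_sub_le (hpq k)
  have hfT : ∀ k, f k * T * h k = 0 := by
    intro k
    ext x
    have h1 : h k x ∈ q k := (q k).sub_mem (closedProj_apply_mem (N.isClosed_of_mem _ (hq k)) x)
        (hpq k (closedProj_apply_mem (N.isClosed_of_mem _ (hp k)) x))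
    have h2 := hT _ (hq k) _ h1
    change closedProj (r k) (T (h k x)) - closedProj (q k) (T (h k x)) = 0
    rw [closedProj_eq_self h2, closedProj_eq_self (hqr k h2), sub_self]
  have ho : ∀ j k, j ≠ k → f j * f k = 0 := by
    intro j k hjk
    have aux : ∀ j k, r j ≤ q k → f j * f k = 0 := by
      intro j k hjk
      simp only [hf, mul_sub, sub_mul, closedProj_mul_of_le hjk,
        closedProj_mul_of_le ((hqr j).trans hjk), closedProj_mul_of_le (hjk.trans (hqr k)),
        closedProj_mul_of_le (((hqr j).trans hjk).trans (hqr k)), sub_self]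
    rcases hd j k hjk with h1 | h1
    · exact aux j k (h1.trans (hpq k))
    · have := congrArg star (aux k j (h1.trans (hpq j)))
      rwa [star_mul, (hfs j).star_eq, (hfs k).star_eq, star_zero] at this
  have hlim := hK.tendsto_norm_mul hf1
    (tendsto_apply_zero_of_pairwise_orthogonal hfs (fun k => closedProj_sub_mul_self (hqr k)) ho)
  obtain ⟨k, hk⟩ := (hlim.eventually (gt_mem_nhds (half_pos hη))).exists
  have e1 : f k * R * h k = f k * ((R * closedProj V - closedProj V * R) - (T + K)) * h k +
      f k * K * h k := by
    have e2 : f k * (R * closedProj V) * h k = f k * R * h k := by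
      rw [mul_assoc, mul_assoc R, hAh, mul_assoc]
    have e3 : f k * (closedProj V * R) * h k = 0 := by
      rw [← mul_assoc (f k), hfA, zero_mul, zero_mul]
    rw [mul_sub (f k), mul_sub (f k), sub_mul _ _ (h k), sub_mul _ _ (h k), e2, e3, mul_add (f k),
      add_mul _ _ (h k), hfT]
    abel
  have e4 : ‖f k * ((R * closedProj V - closedProj V * R) - (T + K)) * h k‖ ≤ 1 * (η / 2) * 1 :=
    (norm_mul_le _ _).trans (mul_le_mul ((norm_mul_le _ _).trans
      (mul_le_mul (hf1 k) hY.le (norm_nonneg _) zero_le_one)) (hh1 k) (norm_nonneg _)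
      (by positivity))
  have e5 : ‖f k * K * h k‖ ≤ ‖f k * K‖ * 1 :=
    (norm_mul_le _ _).trans (by gcongr; exact hh1 k)
  have e6 := hlarge k
  have e7 := norm_add_le (f k * ((R * closedProj V - closedProj V * R) - (T + K)) * h k)
    (f k * K * h k)
  rw [← e1] at e7
  linarith

end GlidingHump

/-! ### A finite partition of the nest into steps -/

section Partition

variable {H : Type*} [NormedAddCommGroup H] [InnerProductSpace ℂ H] [CompleteSpace H]

/-- Test the hypothesis on the projection of `e` itself: the corner of its commutator with `R` is
the corner of `R`. -/
theorem isCompactOperator_of_derives {N : Nest H} {R : H →L[ℂ] H}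
    (hR : ∀ A ∈ nestAlgebra N,
      R * A - A * R ∈ closure (quasiTriangularAlgebra N : Set (H →L[ℂ] H)))
    {e : Submodule ℂ H} (he : e ∈ N.carrier) :
    IsCompactOperator ((1 - closedProj e) * R * closedProj e : H →L[ℂ] H) := by
  have h := isCompactOperator_of_mem_closure_quasiTriangularAlgebra
    (hR _ (N.closedProj_mem he)) he
  have e1 : (1 - closedProj e) * (R * closedProj e - closedProj e * R) * closedProj e =
      (1 - closedProj e) * R * closedProj e := by
    have h2 : (1 - closedProj e) * closedProj e = 0 := by simp [sub_mul]
    rw [mul_sub, ← mul_assoc _ (closedProj e) R, h2, zero_mul, sub_zero, mul_assoc, mul_assoc R,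
      closedProj_mul_self, mul_assoc]
  rwa [e1] at h

/-- The corner of `R` at `e` is compact and the projections of `S` increase strongly to that of the
supremum, so replacing the supremum by a late `c ∈ S` changes the block by an arbitrarily small
norm. -/
theorem exists_large_block_below_sSup {N : Nest H} {R : H →L[ℂ] H} {η : ℝ}
    (hcomp : ∀ e ∈ N.carrier, IsCompactOperator ((1 - closedProj e) * R * closedProj e : H →L[ℂ] H))
    {S : Set (Submodule ℂ H)} (hS : S ⊆ N.carrier) {b e : Submodule ℂ H}
    (he : e ∈ N.carrier) (hbe : b ≤ e) (hes : e < (sSup S).topologicalClosure)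
    (hlarge : η < ‖(closedProj (sSup S).topologicalClosure - closedProj e) * R *
      (closedProj e - closedProj b)‖) :
    ∃ c ∈ S, e ≤ c ∧ η < ‖(closedProj c - closedProj e) * R * (closedProj e - closedProj b)‖ := by
  set s := (sSup S).topologicalClosure with hs
  obtain ⟨c₀, hc₀, hec₀⟩ : ∃ c ∈ S, e ≤ c := by
    by_contra! hcon
    refine hes.not_ge (Submodule.topologicalClosure_minimal _ (sSup_le fun c hc => ?_)
      (N.isClosed_of_mem e he))
    exact (N.chain c (hS hc) e he).resolve_right (hcon c hc)
  have : Nonempty S := ⟨⟨c₀, hc₀⟩⟩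
  have : IsDirectedOrder S := by
    refine ⟨fun x y => ?_⟩
    rcases N.chain _ (hS x.2) _ (hS y.2) with h | h
    · exact ⟨y, h, le_rfl⟩
    · exact ⟨x, le_rfl, h⟩
  have hD : IsCompactOperator ((1 - closedProj e) * R * closedProj e *
      (closedProj e - closedProj b) : H →L[ℂ] H) := (hcomp e he).mul_const _
  have hDe : (1 - closedProj e) * R * closedProj e * (closedProj e - closedProj b) =
      (1 - closedProj e) * R * (closedProj e - closedProj b) := by
    rw [mul_assoc _ (closedProj e), mul_sub (closedProj e), closedProj_mul_self,
      closedProj_mul_of_ge hbe]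
  rw [hDe] at hD
  have hle : ∀ c : S, c.1 ≤ s := fun c => (le_sSup c.2).trans (Submodule.le_topologicalClosure _)
  have hlim := hD.tendsto_norm_mul (F := fun c : S => closedProj s - closedProj c.1)
    (fun c => norm_closedProj_sub_le (hle c)) (tendsto_closedProj_sub_sSup S)
  obtain ⟨c, hc1, hc2⟩ := ((hlim.eventually (gt_mem_nhds (sub_pos.2 hlarge))).and
    (eventually_ge_atTop ⟨c₀, hc₀⟩)).exists
  have hec : e ≤ c.1 := hec₀.trans hc2
  refine ⟨c.1, c.2, hec, ?_⟩
  have e1 : (closedProj s - closedProj e) * R * (closedProj e - closedProj b) =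
      (closedProj s - closedProj c.1) *
        ((1 - closedProj e) * R * (closedProj e - closedProj b)) +
      (closedProj c.1 - closedProj e) * R * (closedProj e - closedProj b) := by
    have h1 : (closedProj s - closedProj c.1) * (1 - closedProj e) =
        closedProj s - closedProj c.1 := by
      simp [mul_sub, sub_mul, closedProj_mul_of_ge hec, closedProj_mul_of_ge (hec.trans (hle c))]
    rw [← mul_assoc, ← mul_assoc, h1]
    noncomm_ring
  have e2 := norm_add_le ((closedProj s - closedProj c.1) *
        ((1 - closedProj e) * R * (closedProj e - closedProj b)))
      ((closedProj c.1 - closedProj e) * R * (closedProj e - closedProj b))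
  rw [← e1] at e2
  linarith

/-- Mirror image of `exists_large_block_below_sSup`: now the right factor varies, so compactness is
used through multiplication from the right. -/
theorem exists_large_block_above_sInf {N : Nest H} {R : H →L[ℂ] H} {η : ℝ}
    (hcomp : ∀ e ∈ N.carrier, IsCompactOperator ((1 - closedProj e) * R * closedProj e : H →L[ℂ] H))
    {S : Set (Submodule ℂ H)} (hS : S ⊆ N.carrier) {b e : Submodule ℂ H}
    (he : e ∈ S) (heb : e ≤ b)
    (hlarge : η < ‖(closedProj b - closedProj e) * R * (closedProj e - closedProj (sInf S))‖) :
    ∃ c ∈ S, c ≤ e ∧ η < ‖(closedProj b - closedProj e) * R * (closedProj e - closedProj c)‖ := by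
  set s := sInf S with hs
  have : Nonempty Sᵒᵈ := ⟨OrderDual.toDual ⟨e, he⟩⟩
  have : IsDirectedOrder Sᵒᵈ := by
    refine ⟨fun x y => ?_⟩
    rcases N.chain _ (hS (OrderDual.ofDual x).2) _ (hS (OrderDual.ofDual y).2) with h | h
    · exact ⟨x, le_rfl, h⟩
    · exact ⟨y, h, le_rfl⟩
  have hD : IsCompactOperator ((closedProj b - closedProj e) *
      ((1 - closedProj e) * R * closedProj e) : H →L[ℂ] H) := (hcomp e (hS he)).const_mul _
  have hDe : (closedProj b - closedProj e) * ((1 - closedProj e) * R * closedProj e) =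
      (closedProj b - closedProj e) * R * closedProj e := by
    have h1 : (closedProj b - closedProj e) * (1 - closedProj e) =
        closedProj b - closedProj e := by
      simp [mul_sub, sub_mul, closedProj_mul_of_ge heb]
    rw [← mul_assoc, ← mul_assoc, h1]
  rw [hDe] at hD
  have hle : ∀ c : S, s ≤ c.1 := fun c => sInf_le c.2
  have hlim := hD.tendsto_norm_mul_right
    (F := fun c : Sᵒᵈ => closedProj (OrderDual.ofDual c).1 - closedProj s)
    (fun c => norm_closedProj_sub_le (hle _)) (fun c => isSelfAdjoint_closedProj_sub _ _)
    (tendsto_closedProj_sub_sInf fun M hM => N.isClosed_of_mem M (hS hM))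
  obtain ⟨c, hc1, hc2⟩ := ((hlim.eventually (gt_mem_nhds (sub_pos.2 hlarge))).and
    (eventually_ge_atTop (OrderDual.toDual ⟨e, he⟩))).exists
  set c' := (OrderDual.ofDual c).1 with hc'
  have hec : c' ≤ e := hc2
  refine ⟨c', (OrderDual.ofDual c).2, hec, ?_⟩
  have e1 : (closedProj b - closedProj e) * R * (closedProj e - closedProj s) =
      (closedProj b - closedProj e) * R * closedProj e * (closedProj c' - closedProj s) +
      (closedProj b - closedProj e) * R * (closedProj e - closedProj c') := by
    have h1 : closedProj e * (closedProj c' - closedProj s) = closedProj c' - closedProj s := by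
      rw [mul_sub, closedProj_mul_of_ge hec, closedProj_mul_of_ge ((hle _).trans hec)]
    rw [mul_assoc _ (closedProj e), h1]
    noncomm_ring
  have e2 := norm_add_le
    ((closedProj b - closedProj e) * R * closedProj e * (closedProj c' - closedProj s))
    ((closedProj b - closedProj e) * R * (closedProj e - closedProj c'))
  rw [← e1] at e2
  linarith

/-- For an operator that derives the nest algebra into the closure of the quasi-triangular algebra,
the nest has a finite partition into steps. -/
theorem reflTransGen_isNestStep_top {N : Nest H} {R : H →L[ℂ] H}
    (hR : ∀ A ∈ nestAlgebra N,
      R * A - A * R ∈ closure (quasiTriangularAlgebra N : Set (H →L[ℂ] H)))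
    {η : ℝ} (hη : 0 < η) : Relation.ReflTransGen (IsNestStep N R η) ⊥ ⊤ := by
  have hcomp := fun e he => isCompactOperator_of_derives hR (e := e) he
  set S : Set (Submodule ℂ H) := {b | Relation.ReflTransGen (IsNestStep N R η) ⊥ b} with hSdef
  have hS : S ⊆ N.carrier := fun b hb => mem_of_reflTransGen_isNestStep hb
  have hbot : (⊥ : Submodule ℂ H) ∈ S := Relation.ReflTransGen.refl
  set s := (sSup S).topologicalClosure with hs
  have hsN : s ∈ N.carrier := N.closedSpan_mem S hS
  have hle : ∀ b ∈ S, b ≤ s := fun b hb => (le_sSup hb).trans (Submodule.le_topologicalClosure _)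
  -- If the supremum were not reachable, no interval from a reachable `b` to `s` would be a step;
  -- each would contain a large block ending at a reachable `c < s`. Restarting from `c` yields
  -- infinitely many disjoint large blocks.
  have hsS : s ∈ S := by
    by_contra hsS
    have hnext : ∀ b : S, ∃ q ∈ N.carrier, ∃ c : S, b.1 ≤ q ∧ q ≤ c.1 ∧
        η < ‖(closedProj c.1 - closedProj q) * R * (closedProj q - closedProj b.1)‖ := by
      intro b
      have h1 : ¬ IsNestStep N R η b.1 s := fun h => hsS (Relation.ReflTransGen.tail b.2 h)
      simp only [IsNestStep, hS b.2, hsN, hle _ b.2, true_and, not_forall, not_le] at h1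
      obtain ⟨e, he, hbe, hes, hlarge⟩ := h1
      have hne : e ≠ s := by
        rintro rfl
        simp at hlarge
        linarith
      obtain ⟨c, hc, hec, hcl⟩ := exists_large_block_below_sSup hcomp hS he hbe
        (lt_of_le_of_ne hes hne) hlarge
      exact ⟨e, he, ⟨c, hc⟩, hbe, hec, hcl⟩
    choose q hq c hbq hqc hlarge using hnext
    let b : ℕ → S := fun k => Nat.rec ⟨⊥, hbot⟩ (fun _ b => c b) k
    have hb : ∀ k, b (k + 1) = c (b k) := fun _ => rfl
    have hmono : Monotone fun k => (b k).1 :=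
      monotone_nat_of_le_succ fun k => (hbq _).trans (hqc _)
    refine false_of_disjoint_blocks hR hη (p := fun k => (b k).1) (q := fun k => q (b k))
      (r := fun k => (c (b k)).1) (fun k => hS (b k).2) (fun k => hq _) (fun k => hS (c _).2)
      (fun k => hbq _) (fun k => hqc _) (fun j k hjk => ?_) (fun k => hlarge _)
    rcases lt_or_gt_of_ne hjk with h | h
    · exact Or.inl (hmono (Nat.succ_le_of_lt h))
    · exact Or.inr (hmono (Nat.succ_le_of_lt h))
  suffices h : s = ⊤ by rwa [← h]
  by_contra hst
  -- No step can start at `s` and end strictly above it. If the elements above `s` decrease to `s`,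
  -- this again gives disjoint large blocks, now descending.
  set T : Set (Submodule ℂ H) := {b | b ∈ N.carrier ∧ s < b} with hT
  have hTN : T ⊆ N.carrier := fun b hb => hb.1
  have htop : (⊤ : Submodule ℂ H) ∈ T := ⟨N.top_mem, lt_top_iff_ne_top.2 hst⟩
  have hiN : sInf T ∈ N.carrier := N.sInf_mem T hTN
  have hsi : s ≤ sInf T := le_sInf fun b hb => hb.2.le
  have hnostep : ∀ b ∈ T, ¬ IsNestStep N R η s b := fun b hb h =>
    hb.2.not_ge (hle b (Relation.ReflTransGen.tail hsS h))
  have hTmem : ∀ e ∈ N.carrier, s ≤ e → e ≠ s → e ∈ T := fun e he hse hne =>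
    ⟨he, lt_of_le_of_ne hse hne.symm⟩
  by_cases his : sInf T = s
  · have hnext : ∀ b : T, ∃ q ∈ N.carrier, ∃ c : T, c.1 ≤ q ∧ q ≤ b.1 ∧
        η < ‖(closedProj b.1 - closedProj q) * R * (closedProj q - closedProj c.1)‖ := by
      intro b
      have h1 := hnostep b.1 b.2
      simp only [IsNestStep, hTN b.2, hsN, b.2.2.le, true_and, not_forall, not_le] at h1
      obtain ⟨e, he, hse, heb, hlarge⟩ := h1
      have hne : e ≠ s := by
        intro h
        rw [h, sub_self, mul_zero, norm_zero] at hlarge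
        linarith
      rw [← his] at hlarge
      obtain ⟨c, hc, hce, hcl⟩ := exists_large_block_above_sInf hcomp hTN (hTmem e he hse hne) heb
        hlarge
      exact ⟨e, he, ⟨c, hc⟩, hce, heb, hcl⟩
    choose q hq c hcq hqb hlarge using hnext
    let b : ℕ → T := fun k => Nat.rec ⟨⊤, htop⟩ (fun _ b => c b) k
    have hanti : Antitone fun k => (b k).1 :=
      antitone_nat_of_succ_le fun k => (hcq _).trans (hqb _)
    refine false_of_disjoint_blocks hR hη (p := fun k => (c (b k)).1) (q := fun k => q (b k))
      (r := fun k => (b k).1) (fun k => hTN (c _).2) (fun k => hq _) (fun k => hTN (b k).2)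
      (fun k => hcq _) (fun k => hqb _) (fun j k hjk => ?_) (fun k => hlarge _)
    rcases lt_or_gt_of_ne hjk with h | h
    · exact Or.inr (hanti (Nat.succ_le_of_lt h))
    · exact Or.inl (hanti (Nat.succ_le_of_lt h))
  -- Otherwise `s` has an immediate successor. The interval between them contains only its
  -- endpoints, whose blocks vanish, so it is a step.
  · refine hnostep _ (hTmem _ hiN hsi his) ⟨hsN, hiN, hsi, fun e he hse hei => ?_⟩
    by_cases hne : e = s
    · simpa [hne] using hη.le
    · have : e = sInf T := le_antisymm hei (sInf_le (hTmem e he hse hne))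
      simpa [this] using hη.le

end Partition

/-! ### Membership in the quasi-triangular algebra by successive halving -/

section QuasiTriangular

variable {H : Type*} [NormedAddCommGroup H] [InnerProductSpace ℂ H] [CompleteSpace H]

theorem mul_sub_mul_mem_closure_of_compact {N : Nest H} {R K : H →L[ℂ] H}
    (hR : ∀ A ∈ nestAlgebra N,
      R * A - A * R ∈ closure (quasiTriangularAlgebra N : Set (H →L[ℂ] H)))
    (hK : IsCompactOperator K) : ∀ A ∈ nestAlgebra N,
      (R - K) * A - A * (R - K) ∈ closure (quasiTriangularAlgebra N : Set (H →L[ℂ] H)) := by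
  intro A hA
  have h1 : K * A - A * K ∈ (quasiTriangularAlgebra N).topologicalClosure :=
    Subalgebra.le_topologicalClosure _ ⟨0, zero_mem _, K * A - A * K,
      (hK.mul_const A).sub (hK.const_mul A), (zero_add _).symm⟩
  have h2 : R * A - A * R ∈ (quasiTriangularAlgebra N).topologicalClosure := hR A hA
  have h3 : (R - K) * A - A * (R - K) = (R * A - A * R) - (K * A - A * K) := by noncomm_ring
  rw [h3]
  exact sub_mem h2 h1

/-- Dividing by `3 d` brings the corners down to 1/3, as the filling argument requires. A partition
with `η = 1/6` leaves corners at most 1/6, and multiplying back gives `3 d / 6 = d / 2`. -/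
theorem exists_compact_halving {N : Nest H} {R : H →L[ℂ] H}
    (hR : ∀ A ∈ nestAlgebra N,
      R * A - A * R ∈ closure (quasiTriangularAlgebra N : Set (H →L[ℂ] H)))
    {d : ℝ} (hd : 0 < d) (hnorm : ∀ e ∈ N.carrier, ‖(1 - closedProj e) * R * closedProj e‖ ≤ d) :
    ∃ K : H →L[ℂ] H, IsCompactOperator K ∧ ‖K‖ ≤ 3 * d ∧
      ∀ e ∈ N.carrier, ‖(1 - closedProj e) * (R - K) * closedProj e‖ ≤ d / 2 := by
  set c : ℂ := ((3 * d : ℝ) : ℂ) with hc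
  have hc0 : c ≠ 0 := by rw [hc]; exact_mod_cast (by positivity : (3 * d : ℝ) ≠ 0)
  have hcn : ‖c‖ = 3 * d := by rw [hc, Complex.norm_real, Real.norm_of_nonneg (by positivity)]
  have hscale : ∀ A ∈ nestAlgebra N, (c⁻¹ • R) * A - A * (c⁻¹ • R) ∈
      closure (quasiTriangularAlgebra N : Set (H →L[ℂ] H)) := by
    intro A hA
    have h1 : R * A - A * R ∈ (quasiTriangularAlgebra N).topologicalClosure := hR A hA
    have h2 : (c⁻¹ • R) * A - A * (c⁻¹ • R) = c⁻¹ • (R * A - A * R) := by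
      rw [smul_mul_assoc, mul_smul_comm, smul_sub]
    rw [h2]
    exact Subalgebra.smul_mem _ h1 _
  have hcomp := fun e he => isCompactOperator_of_derives hscale (e := e) he
  obtain ⟨K, hK, -, hK1, -, hKe⟩ := exists_compact_of_reflTransGen (by norm_num : (0 : ℝ) ≤ 1 / 6)
    hcomp (fun e he => by
      rw [mul_smul_comm, smul_mul_assoc, norm_smul, norm_inv, hcn, inv_mul_le_iff₀ (by positivity)]
      linarith [hnorm e he]) (reflTransGen_isNestStep_top hscale (by norm_num))
  refine ⟨c • K, hK.smul c, ?_, fun e he => ?_⟩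
  · rw [norm_smul, hcn]
    exact mul_le_of_le_one_right (by positivity) hK1
  · have h1 : R - c • K = c • (c⁻¹ • R - K) := by
      rw [smul_sub, smul_inv_smul₀ hc0]
    rw [h1, mul_smul_comm, smul_mul_assoc, norm_smul, hcn]
    have := mul_le_mul_of_nonneg_left (hKe e he le_top) (by positivity : 0 ≤ 3 * d)
    linarith

/-- An operator that derives the nest algebra into the closure of the quasi-triangular algebra
belongs to the quasi-triangular algebra. -/
theorem mem_quasiTriangularAlgebra_of_derives {N : Nest H} {P : H →L[ℂ] H}
    (hP : ∀ A ∈ nestAlgebra N,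
      P * A - A * P ∈ closure (quasiTriangularAlgebra N : Set (H →L[ℂ] H))) :
    P ∈ quasiTriangularAlgebra N := by
  set d : ℕ → ℝ := fun n => (‖P‖ + 1) / 2 ^ n with hd
  have hd0 : ∀ n, 0 < d n := fun n => by positivity
  have hd2 : ∀ n, d n / 2 = d (n + 1) := fun n => by simp only [hd, pow_succ, div_div]
  -- `S` runs through the partial sums of the compact corrections; subtracting them from `P`
  -- preserves the commutator hypothesis, so halving can be repeated.
  let Good : ℕ → (H →L[ℂ] H) → Prop := fun n S => IsCompactOperator S ∧
    ∀ e ∈ N.carrier, ‖(1 - closedProj e) * (P - S) * closedProj e‖ ≤ d n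
  have hstart : Good 0 0 := by
    refine ⟨isCompactOperator_zero, fun e _ => ?_⟩
    calc ‖(1 - closedProj e) * (P - 0) * closedProj e‖ ≤ 1 * ‖P‖ * 1 := by
          rw [sub_zero]
          refine (norm_mul_le _ _).trans (mul_le_mul ((norm_mul_le _ _).trans ?_)
            (norm_closedProj_le e) (norm_nonneg _) (by positivity))
          gcongr
          exact norm_one_sub_closedProj_le e
      _ ≤ d 0 := by simp [hd]
  have hnext : ∀ n (S : {S // Good n S}), ∃ S' : {S // Good (n + 1) S},
      ‖S'.1 - S.1‖ ≤ 3 * d n := by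
    rintro n ⟨S, hS, hSe⟩
    obtain ⟨K, hK, hKn, hKe⟩ := exists_compact_halving
      (mul_sub_mul_mem_closure_of_compact hP hS) (hd0 n) hSe
    refine ⟨⟨S + K, hS.add hK, fun e he => ?_⟩, by simpa using hKn⟩
    rw [← hd2, ← sub_sub]
    exact hKe e he
  choose next hnext' using hnext
  let S : (n : ℕ) → {S // Good n S} := fun n => Nat.rec ⟨0, hstart⟩ next n
  have hS : ∀ n, dist (S n).1 (S (n + 1)).1 ≤ (6 * (‖P‖ + 1)) / 2 / 2 ^ n := by
    intro n
    rw [dist_comm, dist_eq_norm]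
    refine (hnext' n (S n)).trans_eq ?_
    simp only [hd]; ring
  have hcau := cauchySeq_of_le_geometric_two hS
  obtain ⟨K, hK⟩ := cauchySeq_tendsto_of_complete hcau
  have hKc : IsCompactOperator K :=
    isCompactOperator_of_tendsto hK (Eventually.of_forall fun n => (S n).2.1)
  refine ⟨P - K, mem_nestAlgebra_of_mul_closedProj fun e he => ?_, K, hKc, by abel⟩
  have h1 : Tendsto (fun n => (1 - closedProj e) * (P - (S n).1) * closedProj e) atTop
      (𝓝 ((1 - closedProj e) * (P - K) * closedProj e)) :=
    ((tendsto_const_nhds.sub hK).const_mul _).mul_const _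
  have h2 : Tendsto d atTop (𝓝 0) := by
    have := (tendsto_pow_atTop_nhds_zero_of_lt_one (by norm_num : (0 : ℝ) ≤ 1 / 2)
      (by norm_num)).const_mul (‖P‖ + 1)
    simp only [mul_zero] at this
    refine this.congr fun n => ?_
    rw [one_div, inv_pow, ← div_eq_mul_inv]
  exact tendsto_nhds_unique h1 (squeeze_zero_norm (fun n => (S n).2.2 e he) h2)

end QuasiTriangular

/-! ### The bounded generator of the flow and its exponential -/

section Generator

variable {𝔸 : Type*} [NormedRing 𝔸] [NormedAlgebra ℂ 𝔸]

theorem AlgebraFlow.toFun_zero {B : Type*} [NormedRing B] [NormedAlgebra ℂ B] (α : AlgebraFlow B)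
    (b : B) : α.toFun 0 b = b :=
  (α.toFun 0).injective ((α.map_add 0 0 b).symm.trans (by rw [add_zero]; rfl))

theorem AlgebraFlow.exists_lipschitz {B : Type*} [NormedRing B] [NormedAlgebra ℂ B]
    (α : AlgebraFlow B)
    (hα : (fun t : ℝ => ‖((α.toFun t : B ≃A[ℂ] B) : B →L[ℂ] B) - ContinuousLinearMap.id ℂ B‖)
      =O[𝓝 0] (fun t : ℝ => t)) :
    ∃ C ≥ 0, ∃ ε > 0, ∀ t, |t| < ε → ∀ b, ‖α.toFun t b - b‖ ≤ C * |t| * ‖b‖ := by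
  obtain ⟨C, hC, h⟩ := hα.exists_nonneg
  obtain ⟨ε, hε, h2⟩ := Metric.eventually_nhds_iff.1 h.bound
  refine ⟨C, hC, ε, hε, fun t ht b => ?_⟩
  have h3 := h2 (y := t) (by simpa using ht)
  rw [norm_norm, Real.norm_eq_abs] at h3
  exact ContinuousLinearMap.le_of_opNorm_le
    (((α.toFun t : B ≃A[ℂ] B) : B →L[ℂ] B) - ContinuousLinearMap.id ℂ B) h3 b

variable {B : Subalgebra ℂ 𝔸} (α : AlgebraFlow B)

/-- The integrand differs from `α h b - b` by `(α t - id)(α h b - b)`, so the Lipschitz bound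
applies twice and yields a product of two small factors. -/
theorem AlgebraFlow.norm_integral_sub_le [CompleteSpace 𝔸] {C ε : ℝ} (hC : 0 ≤ C)
    (hlip : ∀ t, |t| < ε → ∀ b, ‖α.toFun t b - b‖ ≤ C * |t| * ‖b‖) (b : B)
    {s h : ℝ} (hs : 0 < s) (hsε : s < ε) (hh : 0 < h) (hhε : h < ε) :
    ‖(∫ t in (0 : ℝ)..s, ((α.toFun (t + h) b : 𝔸) - (α.toFun t b : 𝔸))) -
      s • ((α.toFun h b : 𝔸) - (b : 𝔸))‖ ≤ C ^ 2 * (s * h * s) * ‖b‖ := by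
  have hcont : Continuous fun t => ((α.toFun t b : B) : 𝔸) :=
    continuous_subtype_val.comp (α.continuous_apply b)
  have hcont' : Continuous fun t => ((α.toFun (t + h) b : B) : 𝔸) :=
    hcont.comp (continuous_add_const h)
  have e1 : s • ((α.toFun h b : 𝔸) - (b : 𝔸)) =
      ∫ _ in (0 : ℝ)..s, ((α.toFun h b : 𝔸) - (b : 𝔸)) := by
    rw [intervalIntegral.integral_const, sub_zero]
  rw [e1, ← intervalIntegral.integral_sub
    (f := fun t => ((α.toFun (t + h) b : 𝔸) - (α.toFun t b : 𝔸)))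
    ((hcont'.sub hcont).intervalIntegrable _ _) (by simp)]
  have h1 : ∀ t ∈ Set.uIoc 0 s, ‖((α.toFun (t + h) b : 𝔸) - (α.toFun t b : 𝔸)) -
      ((α.toFun h b : 𝔸) - (b : 𝔸))‖ ≤ C * s * (C * h * ‖b‖) := by
    intro t ht
    rw [Set.uIoc_of_le hs.le] at ht
    have h2 := hlip t (by rw [abs_of_pos ht.1]; linarith [ht.2]) (α.toFun h b - b)
    have h3 := hlip h (by rwa [abs_of_pos hh]) b
    rw [abs_of_pos hh] at h3
    rw [abs_of_pos ht.1, map_sub, ← α.map_add] at h2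
    refine le_trans h2 ?_
    have := ht.2
    gcongr
  have h2 := intervalIntegral.norm_integral_le_of_norm_le_const h1
  rw [sub_zero, abs_of_pos hs] at h2
  refine h2.trans_eq (by ring)

/-- The integral of `α (t + h) b - α t b` over `[0, s]` is symmetric in `s` and `h`. It is therefore
close both to `s (α h b - b)` and to `h (α s b - b)`; divide by `s h`. -/
theorem AlgebraFlow.norm_slope_sub_slope_le [CompleteSpace 𝔸] {C ε : ℝ} (hC : 0 ≤ C)
    (hlip : ∀ t, |t| < ε → ∀ b, ‖α.toFun t b - b‖ ≤ C * |t| * ‖b‖) (b : B)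
    {s h : ℝ} (hs : 0 < s) (hsε : s < ε) (hh : 0 < h) (hhε : h < ε) :
    ‖h⁻¹ • ((α.toFun h b : 𝔸) - (b : 𝔸)) - s⁻¹ • ((α.toFun s b : 𝔸) - (b : 𝔸))‖ ≤
      C ^ 2 * (s + h) * ‖b‖ := by
  have hcont : Continuous fun t => ((α.toFun t b : B) : 𝔸) :=
    continuous_subtype_val.comp (α.continuous_apply b)
  have hint : ∀ x y, IntervalIntegrable (fun t => ((α.toFun t b : B) : 𝔸))
      MeasureTheory.volume x y :=
    fun x y => hcont.intervalIntegrable x y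
  have hint' : ∀ c x y, IntervalIntegrable (fun t => ((α.toFun (t + c) b : B) : 𝔸))
      MeasureTheory.volume x y :=
    fun c x y => (hcont.comp (continuous_add_const c)).intervalIntegrable x y
  have h1 := α.norm_integral_sub_le hC hlip b hs hsε hh hhε
  have h2 := α.norm_integral_sub_le hC hlip b hh hhε hs hsε
  have e1 : (∫ t in (0 : ℝ)..s, ((α.toFun (t + h) b : 𝔸) - (α.toFun t b : 𝔸))) =
      ∫ t in (0 : ℝ)..h, ((α.toFun (t + s) b : 𝔸) - (α.toFun t b : 𝔸)) := by
    rw [intervalIntegral.integral_sub (hint' h _ _) (hint _ _),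
      intervalIntegral.integral_sub (hint' s _ _) (hint _ _),
      intervalIntegral.integral_comp_add_right (fun t => ((α.toFun t b : B) : 𝔸)),
      intervalIntegral.integral_comp_add_right (fun t => ((α.toFun t b : B) : 𝔸)),
      zero_add, zero_add, add_comm h s]
    have e2 := intervalIntegral.integral_add_adjacent_intervals (hint 0 h) (hint h (s + h))
    have e3 := intervalIntegral.integral_add_adjacent_intervals (hint 0 s) (hint s (s + h))
    rw [← e3] at e2
    rw [sub_eq_sub_iff_add_eq_add, add_comm, e2, add_comm]
  rw [e1] at h1
  have h3 : ‖s • ((α.toFun h b : 𝔸) - (b : 𝔸)) - h • ((α.toFun s b : 𝔸) - (b : 𝔸))‖ ≤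
      s * h * (C ^ 2 * (s + h) * ‖b‖) := by
    have := norm_sub_le_norm_sub_add_norm_sub (s • ((α.toFun h b : 𝔸) - (b : 𝔸)))
      (∫ t in (0 : ℝ)..h, ((α.toFun (t + s) b : 𝔸) - (α.toFun t b : 𝔸)))
      (h • ((α.toFun s b : 𝔸) - (b : 𝔸)))
    rw [norm_sub_rev] at h1
    linarith
  have e4 : h⁻¹ • ((α.toFun h b : 𝔸) - (b : 𝔸)) - s⁻¹ • ((α.toFun s b : 𝔸) - (b : 𝔸)) =
      (s * h)⁻¹ • (s • ((α.toFun h b : 𝔸) - (b : 𝔸)) - h • ((α.toFun s b : 𝔸) - (b : 𝔸))) := by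
    rw [smul_sub (s * h)⁻¹, smul_smul, smul_smul, mul_inv, mul_assoc, mul_comm h⁻¹ s,
      inv_mul_cancel_left₀ hs.ne', mul_assoc, inv_mul_cancel₀ hh.ne', mul_one]
  rw [e4, norm_smul, Real.norm_of_nonneg (by positivity), inv_mul_le_iff₀ (by positivity)]
  exact h3

theorem AlgebraFlow.exists_tendsto_slope [CompleteSpace 𝔸] {C ε : ℝ} (hC : 0 ≤ C) (hε : 0 < ε)
    (hlip : ∀ t, |t| < ε → ∀ b, ‖α.toFun t b - b‖ ≤ C * |t| * ‖b‖) (b : B) :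
    ∃ d : 𝔸, Tendsto (fun h : ℝ => h⁻¹ • ((α.toFun h b : 𝔸) - (b : 𝔸))) (𝓝[>] 0) (𝓝 d) := by
  rw [← cauchy_map_iff_exists_tendsto, Metric.cauchy_iff]
  refine ⟨inferInstance, fun η hη => ?_⟩
  set r := min ε (η / (2 * (C ^ 2 * ‖b‖ + 1))) with hr
  have hr0 : 0 < r := by positivity
  refine ⟨_, image_mem_map (Ioo_mem_nhdsGT hr0), ?_⟩
  rintro _ ⟨h, hh, rfl⟩ _ ⟨s, hs, rfl⟩
  rw [dist_eq_norm]
  refine (α.norm_slope_sub_slope_le hC hlip b hs.1 (hs.2.trans_le (min_le_left _ _)) hh.1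
    (hh.2.trans_le (min_le_left _ _))).trans_lt ?_
  have h1 : s + h < 2 * (η / (2 * (C ^ 2 * ‖b‖ + 1))) := by
    have := hs.2.trans_le (min_le_right _ _)
    have := hh.2.trans_le (min_le_right _ _)
    linarith
  have h2 : 2 * (η / (2 * (C ^ 2 * ‖b‖ + 1))) * (C ^ 2 * ‖b‖ + 1) = η := by
    field_simp
  have h3 : 0 < s + h := add_pos hs.1 hh.1
  have h4 : 0 ≤ C ^ 2 * ‖b‖ := by positivity
  nlinarith

/-- A flow with `‖α t - id‖ = O(t)` has a bounded generator, which is a derivation into the closure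
of the algebra. -/
theorem AlgebraFlow.exists_generator [CompleteSpace 𝔸]
    (hα : (fun t : ℝ => ‖((α.toFun t : B ≃A[ℂ] B) : B →L[ℂ] B) - ContinuousLinearMap.id ℂ B‖)
      =O[𝓝 0] (fun t : ℝ => t)) :
    ∃ δ : B →ₗ[ℂ] 𝔸, (∃ C ≥ 0, ∀ b, ‖δ b‖ ≤ C * ‖b‖) ∧
      (∀ a b, δ (a * b) = δ a * (b : 𝔸) + (a : 𝔸) * δ b) ∧
      (∀ b, δ b ∈ closure (B : Set 𝔸)) ∧
      ∀ b t, HasDerivWithinAt (fun t => ((α.toFun t b : B) : 𝔸)) (δ (α.toFun t b)) (Set.Ici t) t := by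
  obtain ⟨C, hC, ε, hε, hlip⟩ := α.exists_lipschitz hα
  choose d hd using α.exists_tendsto_slope hC hε hlip
  let δ : B →ₗ[ℂ] 𝔸 :=
    { toFun := d
      map_add' := fun a b => by
        refine tendsto_nhds_unique (hd (a + b)) (((hd a).add (hd b)).congr fun h => ?_)
        rw [_root_.map_add, ← smul_add]
        push_cast
        congr 1
        abel
      map_smul' := fun c b => by
        refine tendsto_nhds_unique (hd (c • b)) (((hd b).const_smul c).congr fun h => ?_)
        rw [map_smul, smul_comm, smul_sub]
        rfl }
  have hδ : ∀ b, Tendsto (fun h : ℝ => h⁻¹ • ((α.toFun h b : 𝔸) - (b : 𝔸))) (𝓝[>] 0) (𝓝 (δ b)) := hd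
  refine ⟨δ, ⟨C, hC, fun b => ?_⟩, fun a b => ?_, fun b => ?_, fun b t => ?_⟩
  · refine le_of_tendsto (hδ b).norm ?_
    filter_upwards [Ioo_mem_nhdsGT hε] with h hh
    have h1 := hlip h (by rw [abs_of_pos hh.1]; exact hh.2) b
    rw [abs_of_pos hh.1] at h1
    rw [norm_smul, Real.norm_of_nonneg (inv_nonneg.2 hh.1.le), inv_mul_le_iff₀ hh.1]
    calc _ = ‖α.toFun h b - b‖ := rfl
      _ ≤ _ := h1
      _ = _ := by ring
  · have hb : Tendsto (fun h : ℝ => ((α.toFun h b : B) : 𝔸)) (𝓝[>] 0) (𝓝 (b : 𝔸)) := by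
      have h1 := ((continuous_subtype_val.comp (α.continuous_apply b)).tendsto 0).mono_left
        (nhdsWithin_le_nhds (s := Set.Ioi 0))
      simpa [Function.comp_def, α.toFun_zero b] using h1
    refine tendsto_nhds_unique (hδ (a * b)) ((((hδ a).mul hb).add ((hδ b).const_mul (a : 𝔸))).congr
      fun h => ?_)
    rw [map_mul, smul_mul_assoc, mul_smul_comm, ← smul_add]
    push_cast
    congr 1
    noncomm_ring
  · refine mem_closure_of_tendsto (hδ b) (Eventually.of_forall fun h => ?_)
    have h1 : h⁻¹ • ((α.toFun h b : 𝔸) - (b : 𝔸)) =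
        (((h⁻¹ : ℝ) : ℂ) • (α.toFun h b - b) : B) := by
      push_cast
      rw [← Complex.ofReal_inv, Complex.coe_smul]
    rw [h1]
    exact Subtype.coe_prop _
  -- By the group law, the right difference quotient at `t` is the one at 0 for the element `α t b`.
  · rw [← hasDerivWithinAt_Ioi_iff_Ici, hasDerivWithinAt_iff_tendsto_slope' (by simp)]
    have h1 : Tendsto (fun y : ℝ => y - t) (𝓝[>] t) (𝓝[>] 0) := by
      refine tendsto_nhdsWithin_iff.2 ⟨?_, ?_⟩
      · have : Tendsto (fun y : ℝ => y - t) (𝓝 t) (𝓝 (t - t)) := tendsto_id.sub_const t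
        rw [sub_self] at this
        exact this.mono_left nhdsWithin_le_nhds
      · filter_upwards [self_mem_nhdsWithin] with y hy
        exact sub_pos.2 (Set.mem_Ioi.1 hy)
    refine ((hδ (α.toFun t b)).comp h1).congr fun y => ?_
    simp only [Function.comp_apply, slope, vsub_eq_sub]
    rw [← α.map_add, sub_add_cancel]

/-- A flow whose generator is the inner derivation of `P` is implemented by `exp (t P)`. -/
theorem AlgebraFlow.eq_exp_of_generator [CompleteSpace 𝔸] {P : 𝔸}
    (h : ∀ b t, HasDerivWithinAt (fun t => ((α.toFun t b : B) : 𝔸))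
      (P * (α.toFun t b : 𝔸) - (α.toFun t b : 𝔸) * P) (Set.Ici t) t) (t : ℝ) (b : B) :
    ((α.toFun t b : B) : 𝔸) =
      NormedSpace.exp ((t : ℂ) • P) * (b : 𝔸) * NormedSpace.exp (-((t : ℂ) • P)) := by
  let _ : NormedAlgebra ℚ 𝔸 := NormedAlgebra.restrictScalars ℚ ℂ 𝔸
  have hinv : ∀ x : 𝔸, NormedSpace.exp x * NormedSpace.exp (-x) = 1 := fun x => by
    rw [← NormedSpace.exp_add_of_commute (Commute.refl x).neg_right, add_neg_cancel,
      NormedSpace.exp_zero]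
  have hpos : ∀ t : ℝ, 0 ≤ t → ∀ b : B, ((α.toFun t b : B) : 𝔸) =
      NormedSpace.exp (t • P) * (b : 𝔸) * NormedSpace.exp (-(t • P)) := by
    intro t ht b
    have hd : ∀ s : ℝ, HasDerivWithinAt (fun s : ℝ => NormedSpace.exp (s • (-P)) *
        ((α.toFun s b : B) : 𝔸) * NormedSpace.exp (s • P)) 0 (Set.Ici s) s := by
      intro s
      have h1 := (hasDerivAt_exp_smul_const (𝕂 := ℝ) (-P) s).hasDerivWithinAt (s := Set.Ici s)
      have h2 := (hasDerivAt_exp_smul_const' (𝕂 := ℝ) P s).hasDerivWithinAt (s := Set.Ici s)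
      have h3 : ∀ x y z : 𝔸, (x * -P * y + x * (P * y - y * P)) * z + x * y * (P * z) = 0 := by
        intro x y z
        noncomm_ring
      exact ((h1.mul (h b s)).mul h2).congr_deriv (h3 _ _ _)
    have hc : ContinuousOn (fun s : ℝ => NormedSpace.exp (s • (-P)) *
        ((α.toFun s b : B) : 𝔸) * NormedSpace.exp (s • P)) (Set.Icc 0 t) := by
      refine Continuous.continuousOn ?_
      have h1 : Continuous fun s : ℝ => ((α.toFun s b : B) : 𝔸) :=
        continuous_subtype_val.comp (α.continuous_apply b)
      have h2 : ∀ Q : 𝔸, Continuous fun s : ℝ => NormedSpace.exp (s • Q) := fun Q =>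
        continuous_iff_continuousAt.2 fun s =>
          (hasDerivAt_exp_smul_const (𝕂 := ℝ) Q s).continuousAt
      exact ((h2 _).mul h1).mul (h2 _)
    have h3 := constant_of_has_deriv_right_zero hc (fun s _ => hd s) t ⟨ht, le_rfl⟩
    simp only [zero_smul, NormedSpace.exp_zero, neg_zero, one_mul, mul_one, α.toFun_zero,
      smul_neg] at h3
    rw [← h3, ← mul_assoc, ← mul_assoc, hinv, one_mul, mul_assoc, hinv, mul_one]
  rw [Complex.coe_smul]
  rcases le_total 0 t with ht | ht
  · exact hpos t ht b
  · have h1 := hpos (-t) (neg_nonneg.2 ht) (α.toFun t b)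
    rw [← α.map_add, neg_add_cancel, α.toFun_zero, neg_smul, neg_neg] at h1
    rw [h1, ← mul_assoc, ← mul_assoc, hinv, one_mul, mul_assoc, hinv, mul_one]

end Generator

/-- An element of the nest either contains `M`, hence the range, or lies strictly below `M`, where
the operator vanishes by the choice of `y`. -/
theorem rankOne_mem_nestAlgebra {H : Type*} [NormedAddCommGroup H] [InnerProductSpace ℂ H]
    {N : Nest H} {M : Submodule ℂ H} (hM : M ∈ N.carrier) {x y : H}
    (hx : x ∈ M) (hy : ∀ L ∈ N.carrier, L < M → y ∈ Lᗮ) :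
    InnerProductSpace.rankOne ℂ x y ∈ nestAlgebra N := by
  intro L hL z hz
  rw [InnerProductSpace.rankOne_apply]
  by_cases h : M ≤ L
  · exact L.smul_mem _ (h hx)
  · have h1 : L < M := lt_of_le_not_ge ((N.chain M hM L hL).resolve_left h) h
    rw [Submodule.inner_left_of_mem_orthogonal hz (hy L hL h1), zero_smul]
    exact L.zero_mem

/-! ### Implementing bounded derivations by operators -/

section Implementation

variable {H : Type*} [NormedAddCommGroup H] [InnerProductSpace ℂ H] [CompleteSpace H]

/-- A bounded family of operators converges along every ultrafilter in the weak operator topology. -/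
theorem exists_weak_operator_limit {ι : Type*} (U : Ultrafilter ι) {Q : ι → H →L[ℂ] H} {C : ℝ}
    (hC : 0 ≤ C) (hQ : ∀ i, ‖Q i‖ ≤ C) :
    ∃ P : H →L[ℂ] H, ∀ x z, Tendsto (fun i => inner ℂ z (Q i x)) U (𝓝 (inner ℂ z (P x))) := by
  have hbd : ∀ x z i, ‖inner ℂ (Q i x) z‖ ≤ C * ‖x‖ * ‖z‖ := fun x z i =>
    (norm_inner_le_norm _ _).trans (by gcongr; exact (Q i).le_of_opNorm_le (hQ i) x)
  have hlim : ∀ x z, ∃ c : ℂ, ‖c‖ ≤ C * ‖x‖ * ‖z‖ ∧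
      Tendsto (fun i => inner ℂ (Q i x) z) U (𝓝 c) := by
    intro x z
    obtain ⟨c, hc, hUc⟩ := (isCompact_closedBall (0 : ℂ) (C * ‖x‖ * ‖z‖)).ultrafilter_le_nhds
      (U.map fun i => inner ℂ (Q i x) z) (by
        rw [Ultrafilter.coe_map, le_principal_iff]
        exact mem_map.2 (univ_mem' fun i => by simpa using hbd x z i))
    exact ⟨c, by simpa using hc, hUc⟩
  choose c hc hUc using hlim
  -- The limits are taken with `Q i x` in the conjugate-linear slot, so that `c x` is a linear
  -- functional and Riesz representation applies; conjugation then gives the stated order.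
  let φ : H → H →L[ℂ] ℂ := fun x => LinearMap.mkContinuous
    { toFun := c x
      map_add' := fun z w => tendsto_nhds_unique (hUc x (z + w)) (by
        simpa [inner_add_right] using (hUc x z).add (hUc x w))
      map_smul' := fun a z => tendsto_nhds_unique (hUc x (a • z)) (by
        simpa [inner_smul_right] using (hUc x z).const_mul a) } (C * ‖x‖) (hc x)
  let p : H → H := fun x => (InnerProductSpace.toDual ℂ H).symm (φ x)
  have hp : ∀ x z, inner ℂ (p x) z = c x z := fun x z =>
    InnerProductSpace.toDual_symm_apply
  have hpl : ∀ x z, Tendsto (fun i => inner ℂ z (Q i x)) U (𝓝 (inner ℂ z (p x))) := by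
    intro x z
    have h1 := hUc x z
    rw [← hp] at h1
    have h2 := (Complex.continuous_conj.tendsto _).comp h1
    rw [inner_conj_symm] at h2
    refine h2.congr fun i => ?_
    exact inner_conj_symm z (Q i x)
  refine ⟨LinearMap.mkContinuous
    { toFun := p
      map_add' := fun x y => ext_inner_left ℂ fun z => tendsto_nhds_unique (hpl (x + y) z) (by
        simpa [inner_add_right] using (hpl x z).add (hpl y z))
      map_smul' := fun a x => ext_inner_left ℂ fun z => tendsto_nhds_unique (hpl (a • x) z) (by
        simpa [inner_smul_right] using (hpl x z).const_mul a) } C (fun x => ?_), hpl⟩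
  calc ‖p x‖ = ‖φ x‖ := (InnerProductSpace.toDual ℂ H).symm.norm_map _
    _ ≤ C * ‖x‖ := LinearMap.mkContinuous_norm_le _ (by positivity) _

/-- A bounded derivation on an algebra that contains all rank one operators with range in an
invariant subspace `V` and a fixed functional is implemented on `V`. -/
theorem exists_implementation_on_submodule {B : Subalgebra ℂ (H →L[ℂ] H)}
    {δ : B →ₗ[ℂ] (H →L[ℂ] H)} {C : ℝ} (hC : 0 ≤ C) (hδ : ∀ b, ‖δ b‖ ≤ C * ‖b‖)
    (hder : ∀ a b, δ (a * b) = δ a * (b : H →L[ℂ] H) + (a : H →L[ℂ] H) * δ b)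
    {V : Submodule ℂ H} (hV : IsClosed (V : Set H)) (hBV : ∀ b : B, ∀ x ∈ V, (b : H →L[ℂ] H) x ∈ V)
    {y : H} (hy : ‖y‖ = 1) (hrank : ∀ x ∈ V, InnerProductSpace.rankOne ℂ x y ∈ B) :
    ∃ Q : H →L[ℂ] H, ‖Q‖ ≤ C ∧ ∀ b : B, ∀ x ∈ V,
      Q ((b : H →L[ℂ] H) x) = δ b x + (b : H →L[ℂ] H) (Q x) := by
  let r : H → B := fun x =>
    ⟨InnerProductSpace.rankOne ℂ (closedProj V x) y, hrank _ (closedProj_apply_mem hV x)⟩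
  have hr : ∀ x, ((r x : B) : H →L[ℂ] H) = InnerProductSpace.rankOne ℂ (closedProj V x) y :=
    fun _ => rfl
  -- The implementer is `Q x = δ(x ⊗ y) y`, extended from `V` to `H` through the projection onto
  -- `V`, which preserves the bound `C`.
  refine ⟨LinearMap.mkContinuous
    { toFun := fun x => δ (r x) y
      map_add' := fun x x' => by
        have : r (x + x') = r x + r x' := by
          ext1
          push_cast
          simp only [hr, map_add, add_apply]
        rw [this, map_add, add_apply]
      map_smul' := fun a x => by
        have : r (a • x) = a • r x := by
          ext1
          push_cast
          simp only [hr, map_smul, smul_apply]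
        rw [this, map_smul, smul_apply, RingHom.id_apply] } C (fun x => ?_), ?_, fun b x hx => ?_⟩
  · change ‖δ (r x) y‖ ≤ C * ‖x‖
    have h1 := (δ (r x)).le_of_opNorm_le (hδ (r x)) y
    have h2 : ‖r x‖ ≤ ‖x‖ := by
      change ‖((r x : B) : H →L[ℂ] H)‖ ≤ _
      rw [hr, InnerProductSpace.norm_rankOne, hy, mul_one]
      exact norm_closedProj_apply_le V x
    rw [hy, mul_one] at h1
    exact h1.trans (by gcongr)
  · exact LinearMap.mkContinuous_norm_le _ hC _
  · change δ (r ((b : H →L[ℂ] H) x)) y = δ b x + (b : H →L[ℂ] H) (δ (r x) y)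
    have h1 : r ((b : H →L[ℂ] H) x) = b * r x := by
      ext1
      push_cast
      rw [hr, hr, closedProj_eq_self hx, closedProj_eq_self (hBV b x hx)]
      exact (InnerProductSpace.comp_rankOne _ _ _).symm
    rw [h1, hder, add_apply, mul_apply_eq_comp, mul_apply_eq_comp, hr, closedProj_eq_self hx]
    simp [hy]

theorem exists_norm_eq_one_mem_orthogonal {M : Submodule ℂ H} (hM : IsClosed (M : Set H))
    (hne : M ≠ ⊤) : ∃ y ∈ Mᗮ, ‖y‖ = 1 := by
  have h1 : Mᗮ ≠ ⊥ := by
    intro h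
    have h2 := Submodule.orthogonal_orthogonal_eq_closure M
    rw [h, hM.submodule_topologicalClosure_eq, Submodule.bot_orthogonal_eq_top] at h2
    exact hne h2.symm
  obtain ⟨y, hy, hy0⟩ := Submodule.exists_mem_ne_zero_of_ne_bot h1
  refine ⟨((‖y‖⁻¹ : ℝ) : ℂ) • y, Submodule.smul_mem _ _ hy, ?_⟩
  rw [norm_smul, Complex.norm_real, norm_inv, norm_norm, inv_mul_cancel₀ (norm_ne_zero_iff.2 hy0)]

/-- Bounded derivations of a nest algebra into `B(H)` are implemented by bounded operators. -/
theorem exists_implementation_nestAlgebra [Nontrivial H] {N : Nest H}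
    {δ : nestAlgebra N →ₗ[ℂ] (H →L[ℂ] H)} {C : ℝ} (hC : 0 ≤ C) (hδ : ∀ b, ‖δ b‖ ≤ C * ‖b‖)
    (hder : ∀ a b, δ (a * b) = δ a * (b : H →L[ℂ] H) + (a : H →L[ℂ] H) * δ b) :
    ∃ P : H →L[ℂ] H, ∀ b, δ b = P * (b : H →L[ℂ] H) - (b : H →L[ℂ] H) * P := by
  set S : Set (Submodule ℂ H) := {M | M ∈ N.carrier ∧ M ≠ ⊤} with hS
  have hSN : S ⊆ N.carrier := fun M hM => hM.1
  -- When the proper elements are dense, each proper `M` has its own `y` orthogonal to it. In the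
  -- other case a single `y`, orthogonal to every proper element, admits all `x ∈ H`.
  by_cases htop : (sSup S).topologicalClosure = ⊤
  · have hloc : ∀ M : S, ∃ Q : H →L[ℂ] H, ‖Q‖ ≤ C ∧ ∀ b : nestAlgebra N, ∀ x ∈ M.1,
        Q ((b : H →L[ℂ] H) x) = δ b x + (b : H →L[ℂ] H) (Q x) := by
      rintro ⟨M, hM, hMt⟩
      obtain ⟨y, hyM, hy⟩ := exists_norm_eq_one_mem_orthogonal (N.isClosed_of_mem M hM) hMt
      exact exists_implementation_on_submodule hC hδ hder (N.isClosed_of_mem M hM)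
        (fun b => b.2 M hM) hy fun x hx => rankOne_mem_nestAlgebra hM hx fun L _ hLM =>
          Submodule.orthogonal_le hLM.le hyM
    choose Q hQ hQder using hloc
    have : Nonempty S := ⟨⟨⊥, N.bot_mem, bot_ne_top⟩⟩
    have : IsDirectedOrder S := by
      refine ⟨fun x y => ?_⟩
      rcases N.chain _ (hSN x.2) _ (hSN y.2) with h | h
      · exact ⟨y, h, le_rfl⟩
      · exact ⟨x, le_rfl, h⟩
    obtain ⟨P, hP⟩ := exists_weak_operator_limit (Ultrafilter.of (atTop : Filter S)) hC hQ
    have hU : (Ultrafilter.of (atTop : Filter S) : Filter S) ≤ atTop := Ultrafilter.of_le _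
    refine ⟨P, fun b => ?_⟩
    -- Once `L ≥ M`, the identity for `Q L` holds at `x`; moving `b` to the other side of the inner
    -- product as its adjoint lets it pass to the weak limit.
    have hM : ∀ M ∈ S, ∀ x ∈ M, δ b x = P ((b : H →L[ℂ] H) x) - (b : H →L[ℂ] H) (P x) := by
      intro M hM x hx
      rw [eq_sub_iff_add_eq]
      refine ext_inner_left ℂ fun z => tendsto_nhds_unique ?_ (hP ((b : H →L[ℂ] H) x) z)
      have h1 := hP x (star (b : H →L[ℂ] H) z)
      simp only [ContinuousLinearMap.star_eq_adjoint,
        ContinuousLinearMap.adjoint_inner_left] at h1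
      rw [inner_add_right]
      refine (h1.const_add _).congr' ?_
      filter_upwards [hU (eventually_ge_atTop ⟨M, hM⟩)] with L hL
      rw [hQder L b x (hL hx), inner_add_right]
    have hker : (sSup S).topologicalClosure ≤
        (δ b - (P * (b : H →L[ℂ] H) - (b : H →L[ℂ] H) * P)).toLinearMap.ker := by
      refine Submodule.topologicalClosure_minimal _ (sSup_le fun M hMS x hx => ?_)
        (ContinuousLinearMap.isClosed_ker _)
      rw [LinearMap.mem_ker]
      change δ b x - (P ((b : H →L[ℂ] H) x) - (b : H →L[ℂ] H) (P x)) = 0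
      rw [hM M hMS x hx, sub_self]
    rw [htop] at hker
    ext x
    have h2 : δ b x - (P ((b : H →L[ℂ] H) x) - (b : H →L[ℂ] H) (P x)) = 0 :=
      hker (Submodule.mem_top (x := x))
    exact sub_eq_zero.1 h2
  · obtain ⟨y, hyM, hy⟩ := exists_norm_eq_one_mem_orthogonal
      (Submodule.isClosed_topologicalClosure _) htop
    obtain ⟨Q, -, hQ⟩ := exists_implementation_on_submodule hC hδ hder (V := ⊤) (by simp)
      (fun _ _ _ => Submodule.mem_top) hy fun x hx => rankOne_mem_nestAlgebra N.top_mem hx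
        fun L hL hLt => Submodule.orthogonal_le
          ((le_sSup (show L ∈ S from ⟨hL, hLt.ne⟩)).trans (Submodule.le_topologicalClosure _)) hyM
    refine ⟨Q, fun b => ?_⟩
    ext x
    exact eq_sub_of_add_eq (hQ b x Submodule.mem_top).symm

/-- Bounded derivations of a quasi-triangular algebra into `B(H)` are implemented by bounded
operators. -/
theorem exists_implementation_quasiTriangularAlgebra [Nontrivial H] {N : Nest H}
    {δ : quasiTriangularAlgebra N →ₗ[ℂ] (H →L[ℂ] H)} {C : ℝ} (hC : 0 ≤ C)
    (hδ : ∀ b, ‖δ b‖ ≤ C * ‖b‖)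
    (hder : ∀ a b, δ (a * b) = δ a * (b : H →L[ℂ] H) + (a : H →L[ℂ] H) * δ b) :
    ∃ P : H →L[ℂ] H, ∀ b, δ b = P * (b : H →L[ℂ] H) - (b : H →L[ℂ] H) * P := by
  obtain ⟨y, hy⟩ := exists_norm_eq H (zero_le_one (α := ℝ))
  obtain ⟨Q, -, hQ⟩ := exists_implementation_on_submodule hC hδ hder (V := ⊤) (by simp)
    (fun _ _ _ => Submodule.mem_top) hy fun x _ => by
      refine ⟨0, zero_mem _, InnerProductSpace.rankOne ℂ x y, ?_, (zero_add _).symm⟩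
      exact (isCompactOperator_of_locallyCompactSpace_dom (innerSL ℂ y)).clm_comp
        (ContinuousLinearMap.toSpanSingleton ℂ x)
  refine ⟨Q, fun b => ?_⟩
  ext x
  exact eq_sub_of_add_eq (hQ b x Submodule.mem_top).symm

end Implementation

/-! ### Conclusion -/

theorem proposition3p2 {H : Type*} [NormedAddCommGroup H] [InnerProductSpace ℂ H]
    [CompleteSpace H] (N : Nest H) (B : Subalgebra ℂ (H →L[ℂ] H))
    (hB : B = nestAlgebra N ∨ B = quasiTriangularAlgebra N)
    (α : AlgebraFlow B)
    (hα : (fun t : ℝ => ‖((α.toFun t : B ≃A[ℂ] B) : B →L[ℂ] B) - ContinuousLinearMap.id ℂ B‖)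
      =O[𝓝 0] (fun t : ℝ => t)) :
    ∃ P : B, ∀ (t : ℝ) (A : B),
      ((α.toFun t A : B) : H →L[ℂ] H) =
        NormedSpace.exp ((t : ℂ) • (P : H →L[ℂ] H)) * (A : H →L[ℂ] H) *
          NormedSpace.exp (-((t : ℂ) • (P : H →L[ℂ] H))) := by
  -- The zero space is treated apart because the implementation needs a unit vector.
  cases subsingleton_or_nontrivial H with
  | inl _ => exact ⟨0, fun t A => Subsingleton.elim _ _⟩
  | inr _ =>
    obtain ⟨δ, ⟨C, hC, hδ⟩, hder, hcl, hderiv⟩ := α.exists_generator hα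
    suffices h : ∃ P ∈ B, ∀ b, δ b = P * (b : H →L[ℂ] H) - (b : H →L[ℂ] H) * P by
      obtain ⟨P, hPB, hP⟩ := h
      refine ⟨⟨P, hPB⟩, α.eq_exp_of_generator fun b t => ?_⟩
      rw [← hP]
      exact hderiv b t
    rcases hB with rfl | rfl
    · obtain ⟨P, hP⟩ := exists_implementation_nestAlgebra hC hδ hder
      refine ⟨P, mem_nestAlgebra_of_mul_closedProj fun M hM => ?_, hP⟩
      -- The commutator of `P` with a nest projection lies in the closed nest algebra, and its
      -- corner is the corner of `P`, which therefore vanishes.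
      have h1 := hcl ⟨closedProj M, N.closedProj_mem hM⟩
      rw [(isClosed_nestAlgebra N).closure_eq, hP] at h1
      have h2 := mul_closedProj_of_mem_nestAlgebra h1 hM
      have h3 : (1 - closedProj M) * closedProj M = 0 := by simp [sub_mul]
      rwa [mul_sub, ← mul_assoc _ (closedProj M) P, h3, zero_mul, sub_zero, mul_assoc, mul_assoc P,
        closedProj_mul_self, ← mul_assoc] at h2
    · obtain ⟨P, hP⟩ := exists_implementation_quasiTriangularAlgebra hC hδ hder
      refine ⟨P, mem_quasiTriangularAlgebra_of_derives fun A hA => ?_, hP⟩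
      rw [← hP ⟨A, nestAlgebra_le_quasiTriangularAlgebra N hA⟩]
      exact hcl _
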